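/- Let $b>0$ and $\rho>0$. On $L^2(\mathbb{R}^2)$ let $\mathbf{L}=\mathbf{p}_1^2+(\mathbf{p}_2+b\,x_1)^2$, with $\mathbf{p}_j=-\mathrm{i}\partial_j$, be the (nonnegative self-adjoint) Landau operator, and for $\mathbf{R}\in\mathbb{R}^2$ let $\mathfrak{m}_{\mathbf{R}}$ be the magnetic translation $$(\mathfrak{m}_{\mathbf{R}} f)(\mathbf{x})=\mathrm{e}^{-\mathrm{i} b R_1 x_2}\, f(\mathbf{x}-\mathbf{R}).$$ For a nonnegative self-adjoint operator $A$ on $L^2(\mathbb{R}^2)$, its trace per unit surface is, when the limit exists in $[0,\infty]$, $$\underline{\mathrm{Tr}}_2(A)=\lim_{L\to\infty}\frac1{L^2}\,\mathrm{Tr}\big(\mathbf 1_{\Gamma_L} A\,\mathbf 1_{\Gamma_L}\big),\qquad \Gamma_L=\Big[-\frac L2,\frac L2\Big]^2,$$ where the trace is computed from the quadratic form of $A$ (equal to $+\infty$ off its form domain). For bounded $\eta\ge0$, $\underline{\mathrm{Tr}}_2(\mathbf{L}\eta)$ stands for $\underline{\mathrm{Tr}}_2(\eta^{1/2}\mathbf{L}\,\eta^{1/2})$,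 and $\rho_\eta=\rho$ means that $\mathrm{Tr}(\mathbf 1_Q\eta\mathbf 1_Q)=\rho\,|Q|$ for every bounded measurable $Q\subset\mathbb{R}^2$. Define the kinetic energy density of the two-dimensional homogeneous electron gas by $$\omega^{2d}(b,\rho)=\inf\Big\{\tfrac12\,\underline{\mathrm{Tr}}_2(\mathbf{L}\eta)\;:\;\eta \text{ bounded self-adjoint on } L^2(\mathbb{R}^2),\ 0\le\eta\le1,\ \rho_\eta=\rho,\ [\eta,\mathfrak{m}_{\mathbf{R}}]=0\ \text{for all } \mathbf{R}\in\mathbb{R}^2\Big\}.$$ Then $$\omega^{2d}(b,\rho)=\pi\rho^2+\frac{b^2}{4\pi}\Big\{\frac{2\pi\rho}{b}\Big\}\Big(1-\Big\{\frac{2\pi\rho}{b}\Big\}\Big),$$ where $\{x\}=x-\lfloor x\rfloor$ is the fractional part of $x$. -/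

import Mathlib

open MeasureTheory Filter Topology
open scoped ENNReal

noncomputable section

namespace LandauGas

/-- The Hilbert space `L²(ℝ²; ℂ)`. -/
abbrev L2 : Type := Lp ℂ 2 (volume : Measure (ℝ × ℝ))

/-! ### Multiplication by an indicator function -/

/-- Multiplication by the indicator function `1_Q`, as a bounded operator on `L²(ℝ²)`. -/
def cutoff (Q : Set (ℝ × ℝ)) (hQ : MeasurableSet Q) : L2 →L[ℂ] L2 :=
  LinearMap.mkContinuous
    { toFun := fun f => ((Lp.memLp f).indicator hQ).toLp (Q.indicator f)
      map_add' := by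
        intro f g
        rw [← MemLp.toLp_add, MemLp.toLp_eq_toLp_iff]
        filter_upwards [Lp.coeFn_add f g] with x hx
        by_cases hxQ : x ∈ Q
        · simpa [hxQ] using hx
        · simp [hxQ]
      map_smul' := by
        intro c f
        rw [RingHom.id_apply, ← MemLp.toLp_const_smul, MemLp.toLp_eq_toLp_iff]
        filter_upwards [Lp.coeFn_smul c f] with x hx
        by_cases hxQ : x ∈ Q <;> simp [hxQ, hx] }
    1 (by
      intro f
      rw [one_mul]
      refine Lp.norm_le_norm_of_ae_le ?_
      filter_upwards [((Lp.memLp f).indicator hQ).coeFn_toLp] with x hx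
      simp only [LinearMap.coe_mk, AddHom.coe_mk]
      rw [hx]
      exact norm_indicator_le_norm_self f x)

/-! ### Magnetic translations -/

/-- The pointwise formula `e^{-i b R₁ x₂} f(x - R)`. -/
def magFun (b : ℝ) (R : ℝ × ℝ) (f : ℝ × ℝ → ℂ) (x : ℝ × ℝ) : ℂ :=
  Complex.exp (-Complex.I * ((b * R.1 * x.2 : ℝ) : ℂ)) * f (x - R)

theorem norm_magFun (b : ℝ) (R : ℝ × ℝ) (f : ℝ × ℝ → ℂ) (x : ℝ × ℝ) :
    ‖magFun b R f x‖ = ‖f (x - R)‖ := by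
  have h : -Complex.I * ((b * R.1 * x.2 : ℝ) : ℂ)
      = ((-(b * R.1 * x.2) : ℝ) : ℂ) * Complex.I := by
    push_cast; ring
  rw [magFun, norm_mul, h, Complex.norm_exp_ofReal_mul_I, one_mul]

theorem memLp_magFun (b : ℝ) (R : ℝ × ℝ) {f : ℝ × ℝ → ℂ}
    (hf : MemLp f 2 (volume : Measure (ℝ × ℝ))) :
    MemLp (magFun b R f) 2 (volume : Measure (ℝ × ℝ)) := by
  have hc : MemLp (fun x => f (x - R)) 2 (volume : Measure (ℝ × ℝ)) :=
    hf.comp_measurePreserving (measurePreserving_sub_right volume R)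
  refine hc.of_le ?_ (Eventually.of_forall fun x => (norm_magFun b R f x).le)
  refine AEStronglyMeasurable.mul ?_ hc.1
  refine Continuous.aestronglyMeasurable ?_
  fun_prop

/-- The magnetic translation `(𝔪_R f)(x) = e^{-i b R₁ x₂} f(x - R)` on `L²(ℝ²)`. -/
def magTranslation (b : ℝ) (R : ℝ × ℝ) : L2 →L[ℂ] L2 :=
  LinearMap.mkContinuous
    { toFun := fun f => (memLp_magFun b R (Lp.memLp f)).toLp (magFun b R f)
      map_add' := by
        intro f g
        rw [← MemLp.toLp_add, MemLp.toLp_eq_toLp_iff]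
        have h := (measurePreserving_sub_right (volume : Measure (ℝ × ℝ)) R)
          |>.quasiMeasurePreserving.ae (Lp.coeFn_add f g)
        filter_upwards [h] with x hx
        simp only [magFun, Pi.add_apply] at hx ⊢
        rw [hx, mul_add]
      map_smul' := by
        intro c f
        rw [RingHom.id_apply, ← MemLp.toLp_const_smul, MemLp.toLp_eq_toLp_iff]
        have h := (measurePreserving_sub_right (volume : Measure (ℝ × ℝ)) R)
          |>.quasiMeasurePreserving.ae (Lp.coeFn_smul c f)
        filter_upwards [h] with x hx
        simp only [magFun, Pi.smul_apply, smul_eq_mul] at hx ⊢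
        rw [hx]; ring }
    1 (by
      intro f
      rw [one_mul]
      simp only [LinearMap.coe_mk, AddHom.coe_mk]
      rw [Lp.norm_toLp, Lp.norm_def]
      refine ENNReal.toReal_mono (Lp.eLpNorm_ne_top f) (le_of_eq ?_)
      rw [eLpNorm_congr_norm_ae (g := fun x => f (x - R))
        (Eventually.of_forall fun x => norm_magFun b R f x)]
      exact eLpNorm_comp_measurePreserving (Lp.aestronglyMeasurable f)
        (measurePreserving_sub_right volume R))

/-! ### The Landau operator -/

/-- `v = (-i ∂_e + a) u` in the sense of (tempered) distributions, for `u, v ∈ L²(ℝ²)`, a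
direction `e` and a real function `a` (one component of a vector potential). -/
def IsMagneticMomentum (e : ℝ × ℝ) (a : ℝ × ℝ → ℝ) (u v : L2) : Prop :=
  ∀ φ : SchwartzMap (ℝ × ℝ) ℂ,
    ∫ x, v x * φ x = ∫ x, u x * (Complex.I * fderiv ℝ φ x e + (a x : ℂ) * φ x)

/-- The quadratic form of the Landau operator `L = p₁² + (p₂ + b x₁)²`: it is
`‖p₁ u‖² + ‖(p₂ + b x₁) u‖²` when `p₁ u` and `(p₂ + b x₁) u` are in `L²` (that is, for `u` in the
domain of `L^{1/2}`, and then it is `‖L^{1/2} u‖²`), and `∞` otherwise. -/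
def landauForm (b : ℝ) (u : L2) : ℝ≥0∞ :=
  ⨅ (v₁ : L2) (v₂ : L2) (_ : IsMagneticMomentum (1, 0) (fun _ => 0) u v₁)
    (_ : IsMagneticMomentum (0, 1) (fun x => b * x.1) u v₂), ‖v₁‖ₑ ^ 2 + ‖v₂‖ₑ ^ 2

/-! ### Traces

A nonnegative self-adjoint operator `A`, bounded or not, enters through its quadratic form
`f ↦ ⟨f, A f⟩ ∈ [0, ∞]`, which is `∞` off the form domain. -/

/-- An index set of a Hilbert basis of `L²(ℝ²)`. -/
def basisIndex : Set L2 := (exists_hilbertBasis ℂ L2).choose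

/-- A Hilbert basis of `L²(ℝ²)`. -/
def basis : HilbertBasis basisIndex ℂ L2 := (exists_hilbertBasis ℂ L2).choose_spec.choose

/-- The local trace `Tr(1_Q A 1_Q) = ∑ᵢ ⟨1_Q eᵢ, A 1_Q eᵢ⟩ ∈ [0, ∞]` of a nonnegative self-adjoint
operator with quadratic form `a`. For such forms the sum does not depend on the basis. -/
def localTrace (a : L2 → ℝ≥0∞) (Q : Set (ℝ × ℝ)) (hQ : MeasurableSet Q) : ℝ≥0∞ :=
  ∑' i, a (cutoff Q hQ (basis i))

/-- The square `Γ_L = [-L/2, L/2]²`. -/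
def square (L : ℝ) : Set (ℝ × ℝ) := Set.Icc (-L / 2) (L / 2) ×ˢ Set.Icc (-L / 2) (L / 2)

theorem measurableSet_square (L : ℝ) : MeasurableSet (square L) :=
  measurableSet_Icc.prod measurableSet_Icc

/-- `t` is the trace per unit surface `lim_{L → ∞} L⁻² Tr(1_{Γ_L} A 1_{Γ_L})`. -/
def IsTracePerSurface (a : L2 → ℝ≥0∞) (t : ℝ≥0∞) : Prop :=
  Tendsto (fun L : ℝ => localTrace a (square L) (measurableSet_square L) / ENNReal.ofReal (L ^ 2))
    atTop (𝓝 t)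

/-- The quadratic form of a bounded nonnegative operator. -/
def opForm (η : L2 →L[ℂ] L2) (f : L2) : ℝ≥0∞ := ENNReal.ofReal (RCLike.re (inner ℂ f (η f)))

/-- The nonnegative square root of a bounded nonnegative operator on a complex Hilbert space. -/
def opSqrt {H : Type*} [NormedAddCommGroup H] [InnerProductSpace ℂ H] [CompleteSpace H]
    (T : H →L[ℂ] H) : H →L[ℂ] H := CFC.sqrt T

/-- The quadratic form `f ↦ ‖L^{1/2} η^{1/2} f‖²` of the nonnegative operator `η^{1/2} L η^{1/2}`,
where `L` is the Landau operator. The trace per unit surface of `L η` is understood as the one of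
this operator. -/
def kineticForm (b : ℝ) (η : L2 →L[ℂ] L2) (f : L2) : ℝ≥0∞ := landauForm b (opSqrt η f)

/-- The nonnegative operator `η` has density `r`: `Tr(1_Q η 1_Q) = ∫_Q r` for every bounded
measurable set `Q`. -/
def HasDensity (η : L2 →L[ℂ] L2) (r : ℝ × ℝ → ℝ) : Prop :=
  ∀ (Q : Set (ℝ × ℝ)) (hQ : MeasurableSet Q), Bornology.IsBounded Q →
    localTrace (opForm η) Q hQ = ∫⁻ x in Q, ENNReal.ofReal (r x)

/-! ### The kinetic energy density -/

/-- The admissible states: bounded self-adjoint `η` on `L²(ℝ²)` with `0 ≤ η ≤ 1`, constant density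
`ρ`, and commuting with all the magnetic translations. -/
structure IsAdmissible (b ρ : ℝ) (η : L2 →L[ℂ] L2) : Prop where
  selfAdjoint : IsSelfAdjoint η
  nonneg : 0 ≤ η
  le_one : η ≤ 1
  density : HasDensity η fun _ => ρ
  invariant : ∀ R : ℝ × ℝ, Commute η (magTranslation b R)

/-- The kinetic energy density `ω^{2d}(b, ρ)`, the infimum in `[0, ∞]` of half the trace per unit
surface of `L η` over the admissible states `η`. -/
def omega2d (b ρ : ℝ) : ℝ≥0∞ :=
  sInf {w : ℝ≥0∞ | ∃ (η : L2 →L[ℂ] L2) (t : ℝ≥0∞),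
    IsAdmissible b ρ η ∧ IsTracePerSurface (kineticForm b η) t ∧ w = t / 2}

end LandauGas

end

noncomputable section

namespace LandauGas

open scoped LineDeriv ContDiff

/-! ### Parseval's identity in `ℝ≥0∞` -/

/-! The Landau operator is `b (2 a* a + 1)` for a ladder operator `a` built from the kinetic
momenta, so its spectrum consists of the levels `b (2 n + 1)`. A second ladder, built from the
pseudo-momenta, commutes with the first and labels the states inside each level. Applying both
raising operators to a Gaussian gives functions `psi n m`, which form a Hilbert basis. With `P n`
the projection onto level `n`, the quadratic form of `L` at `u` is the sum over `n` of `b (2 n + 1)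
‖P n u‖²`.

Every level has density `b / 2π`. For `n = 0` this is an explicit exponential series. For the others
it follows from a trace property: if `T` commutes with the magnetic translations and `Q` is a
centred square, then `1_Q T* T 1_Q` and `1_Q T T* 1_Q` have the same trace
(`hsNormSq_cell_adjoint`). This is applied to the partial isometry carrying level 0 onto level `n`,
and uniqueness of Haar measure passes from squares to all measurable sets.

Upper bound: with `x = 2πρ/b`, `N = ⌊x⌋` and `θ = {x}`, filling the levels below `N` completely and
level `N` with weight `θ` gives density `ρ` and half trace per unit surface `b²/4π (N² + (2N+1) θ)`,
which is the claimed value.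

Lower bound: for admissible `η` and a centred square `Q`, let `τ n` be the squared Hilbert–Schmidt
norm of `P n η^{1/2} 1_Q`. The `τ n` sum to `ρ |Q|`. By the trace property and `η ≤ 1`, each is at
most the trace of `1_Q P n 1_Q`, namely `b |Q| / 2π`. The local kinetic energy is at least the sum
of `b (2n+1) τ n`, and the bathtub principle (`bathtub`) says that filling the lowest levels first
is optimal. No classification of the operators commuting with the translations is needed: the trace
property alone bounds the occupations. -/

theorem enorm_sq_eq_tsum_enorm_inner {ι E : Type*} [NormedAddCommGroup E] [InnerProductSpace ℂ E]
    (e : HilbertBasis ι ℂ E) (x : E) : ‖x‖ₑ ^ 2 = ∑' i, ‖inner ℂ (e i) x‖ₑ ^ 2 := by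
  have h := (e.hasSum_inner_mul_inner x x)
  have h2 : HasSum (fun i => ‖inner ℂ (e i) x‖ ^ 2) (‖x‖ ^ 2) := by
    have := (Complex.hasSum_re h)
    convert this using 1
    · ext i
      rw [← inner_conj_symm x (e i), mul_comm, Complex.mul_conj, Complex.ofReal_re,
        Complex.normSq_eq_norm_sq]
    · rw [← inner_self_eq_norm_sq (𝕜 := ℂ)]; rfl
  simp_rw [← ofReal_norm, ← ENNReal.ofReal_pow (norm_nonneg _)]
  rw [← h2.tsum_eq, ENNReal.ofReal_tsum_of_nonneg (fun _ => by positivity) h2.summable]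

/-! ### Hilbert–Schmidt norms -/

/-- The square of the Hilbert–Schmidt norm of an operator defined on `L²(ℝ²)`. -/
def hsNormSq {F : Type*} [NormedAddCommGroup F] [NormedSpace ℂ F] (T : L2 →L[ℂ] F) : ℝ≥0∞ :=
  ∑' i, ‖T (basis i)‖ₑ ^ 2

/-- Parseval turns both sides into the same double sum of squared matrix elements. This symmetry
stands in for basis independence: `hsNormSq` is tied to one fixed basis, and operators on the right
are removed by passing to the adjoint. -/
theorem hsNormSq_adjoint (T : L2 →L[ℂ] L2) :
    hsNormSq (ContinuousLinearMap.adjoint T) = hsNormSq T := by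
  simp only [hsNormSq, enorm_sq_eq_tsum_enorm_inner basis]
  rw [ENNReal.tsum_comm]
  refine tsum_congr fun i => tsum_congr fun j => ?_
  rw [ContinuousLinearMap.adjoint_inner_right, ← inner_conj_symm, RCLike.enorm_conj]

theorem hsNormSq_congr {F G : Type*} [NormedAddCommGroup F] [NormedSpace ℂ F]
    [NormedAddCommGroup G] [NormedSpace ℂ G] {S : L2 →L[ℂ] F} {T : L2 →L[ℂ] G}
    (h : ∀ f, ‖S f‖ₑ = ‖T f‖ₑ) : hsNormSq S = hsNormSq T := by
  simp only [hsNormSq, h]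

theorem hsNormSq_mono {F G : Type*} [NormedAddCommGroup F] [NormedSpace ℂ F]
    [NormedAddCommGroup G] [NormedSpace ℂ G] {S : L2 →L[ℂ] F} {T : L2 →L[ℂ] G}
    (h : ∀ f, ‖S f‖ₑ ≤ ‖T f‖ₑ) : hsNormSq S ≤ hsNormSq T :=
  ENNReal.tsum_le_tsum fun i => by gcongr; exact h _

theorem hsNormSq_mul_of_isometry_adjoint (T : L2 →L[ℂ] L2) {U : L2 →L[ℂ] L2}
    (hU : ∀ f, ‖ContinuousLinearMap.adjoint U f‖ₑ = ‖f‖ₑ) : hsNormSq (T * U) = hsNormSq T := by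
  rw [← hsNormSq_adjoint, ← hsNormSq_adjoint T]
  refine hsNormSq_congr fun f => ?_
  change ‖ContinuousLinearMap.adjoint (T ∘L U) f‖ₑ = _
  rw [ContinuousLinearMap.adjoint_comp]
  exact hU _

/-! ### Cutoffs -/

theorem coeFn_cutoff {Q : Set (ℝ × ℝ)} (hQ : MeasurableSet Q) (f : L2) :
    cutoff Q hQ f =ᵐ[volume] Q.indicator f :=
  ((Lp.memLp f).indicator hQ).coeFn_toLp

theorem enorm_sq_eq_lintegral (f : L2) : ‖f‖ₑ ^ 2 = ∫⁻ x, ‖f x‖ₑ ^ 2 := by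
  rw [Lp.enorm_def, eLpNorm_eq_lintegral_rpow_enorm_toReal two_ne_zero ENNReal.ofNat_ne_top]
  simp only [ENNReal.toReal_ofNat, ENNReal.rpow_ofNat]
  rw [← ENNReal.rpow_natCast, ← ENNReal.rpow_mul]
  norm_num

theorem enorm_cutoff_sq {Q : Set (ℝ × ℝ)} (hQ : MeasurableSet Q) (f : L2) :
    ‖cutoff Q hQ f‖ₑ ^ 2 = ∫⁻ x in Q, ‖f x‖ₑ ^ 2 := by
  rw [enorm_sq_eq_lintegral, ← lintegral_indicator hQ]
  refine lintegral_congr_ae ?_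
  filter_upwards [coeFn_cutoff hQ f] with x hx
  rw [hx]
  by_cases h : x ∈ Q <;> simp [h]

theorem cutoff_congr {Q Q' : Set (ℝ × ℝ)} (hQ : MeasurableSet Q) (hQ' : MeasurableSet Q')
    (h : Q =ᵐ[volume] Q') : cutoff Q hQ = cutoff Q' hQ' := by
  ext1 f
  refine Lp.ext ?_
  refine (coeFn_cutoff hQ f).trans (EventuallyEq.trans ?_ (coeFn_cutoff hQ' f).symm)
  exact indicator_ae_eq_of_ae_eq_set h

theorem isSelfAdjoint_cutoff {Q : Set (ℝ × ℝ)} (hQ : MeasurableSet Q) :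
    ContinuousLinearMap.adjoint (cutoff Q hQ) = cutoff Q hQ := by
  symm
  rw [ContinuousLinearMap.eq_adjoint_iff]
  intro f g
  rw [L2.inner_def, L2.inner_def]
  refine integral_congr_ae ?_
  filter_upwards [coeFn_cutoff hQ f, coeFn_cutoff hQ g] with x hf hg
  rw [hf, hg]
  by_cases h : x ∈ Q <;> simp [h]

/-! ### Magnetic translations -/

theorem coeFn_magTranslation (b : ℝ) (R : ℝ × ℝ) (f : L2) :
    magTranslation b R f =ᵐ[volume] magFun b R f :=
  (memLp_magFun b R (Lp.memLp f)).coeFn_toLp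

theorem enorm_magTranslation (b : ℝ) (R : ℝ × ℝ) (f : L2) : ‖magTranslation b R f‖ₑ = ‖f‖ₑ := by
  rw [Lp.enorm_def, Lp.enorm_def, eLpNorm_congr_ae (coeFn_magTranslation b R f),
    eLpNorm_congr_norm_ae (g := fun x => f (x - R))
        (Eventually.of_forall fun x => norm_magFun b R f x)]
  exact eLpNorm_comp_measurePreserving (Lp.aestronglyMeasurable f)
        (measurePreserving_sub_right volume R)

/-- The magnetic translations form only a projective representation: opposite translations compose
to a phase. This is enough for surjectivity, hence unitarity. -/
theorem magTranslation_mul_neg (b : ℝ) (R : ℝ × ℝ) (f : L2) :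
    magTranslation b R (magTranslation b (-R) f) =
      Complex.exp (-Complex.I * ((b * R.1 * R.2 : ℝ) : ℂ)) • f := by
  refine Lp.ext ?_
  refine (coeFn_magTranslation b R _).trans (EventuallyEq.trans ?_ (Lp.coeFn_smul _ f).symm)
  have h := (measurePreserving_sub_right (volume : Measure (ℝ × ℝ)) R)
          |>.quasiMeasurePreserving.ae (coeFn_magTranslation b (-R) f)
  filter_upwards [h] with x hx
  rw [magFun, hx]
  simp only [magFun, Pi.smul_apply, smul_eq_mul, sub_neg_eq_add, sub_add_cancel]
  rw [← mul_assoc, ← Complex.exp_add]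
  congr 2
  simp
  ring

theorem magTranslation_surjective (b : ℝ) (R : ℝ × ℝ) :
    Function.Surjective (magTranslation b R) := by
  intro f
  refine ⟨magTranslation b (-R) (Complex.exp (Complex.I * ((b * R.1 * R.2 : ℝ) : ℂ)) • f), ?_⟩
  rw [magTranslation_mul_neg, smul_smul, ← Complex.exp_add]
  simp

theorem adjoint_magTranslation_apply (b : ℝ) (R : ℝ × ℝ) (f : L2) :
    ContinuousLinearMap.adjoint (magTranslation b R) (magTranslation b R f) = f := by
  have := (ContinuousLinearMap.norm_map_iff_adjoint_comp_self (magTranslation b R)).1 (fun f => by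
    have := enorm_magTranslation b R f
    rw [← toReal_enorm, this, toReal_enorm])
  exact congrArg (fun T : L2 →L[ℂ] L2 => T f) this

theorem magTranslation_adjoint_apply (b : ℝ) (R : ℝ × ℝ) (f : L2) :
    magTranslation b R (ContinuousLinearMap.adjoint (magTranslation b R) f) = f := by
  obtain ⟨g, rfl⟩ := magTranslation_surjective b R f
  rw [adjoint_magTranslation_apply]

theorem enorm_adjoint_magTranslation (b : ℝ) (R : ℝ × ℝ) (f : L2) :
    ‖ContinuousLinearMap.adjoint (magTranslation b R) f‖ₑ = ‖f‖ₑ := by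
  rw [← enorm_magTranslation b R, magTranslation_adjoint_apply]

theorem cutoff_magTranslation {Q Q' : Set (ℝ × ℝ)} (hQ : MeasurableSet Q) (hQ' : MeasurableSet Q')
    (b : ℝ) (R : ℝ × ℝ) (h : ∀ x, x ∈ Q ↔ x - R ∈ Q') (f : L2) :
    cutoff Q hQ (magTranslation b R f) = magTranslation b R (cutoff Q' hQ' f) := by
  refine Lp.ext ?_
  have h' := (measurePreserving_sub_right (volume : Measure (ℝ × ℝ)) R)
          |>.quasiMeasurePreserving.ae (coeFn_cutoff hQ' f)
  filter_upwards [coeFn_cutoff hQ (magTranslation b R f), coeFn_magTranslation b R f,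
    coeFn_magTranslation b R (cutoff Q' hQ' f), h'] with x h1 h2 h3 h4
  rw [h1, h3, magFun, h4]
  by_cases hx : x ∈ Q
  · simp [hx, (h x).1 hx, h2, magFun]
  · simp [hx, mt (h x).2 hx]

/-- Conjugating by the unitary translation moves `Q` to `Q'` and leaves `T` unchanged, so local
traces of invariant operators are translation invariant. -/
theorem hsNormSq_cutoff_translate {Q Q' : Set (ℝ × ℝ)} (hQ : MeasurableSet Q)
    (hQ' : MeasurableSet Q') (b : ℝ) (R : ℝ × ℝ) (h : ∀ x, x ∈ Q ↔ x - R ∈ Q')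
    {T : L2 →L[ℂ] L2} (hT : Commute T (magTranslation b R)) :
    hsNormSq (T * cutoff Q hQ) = hsNormSq (T * cutoff Q' hQ') := by
  rw [← hsNormSq_mul_of_isometry_adjoint _ (enorm_adjoint_magTranslation b R)]
  refine hsNormSq_congr fun f => ?_
  change ‖T (cutoff Q hQ (magTranslation b R f))‖ₑ = ‖T (cutoff Q' hQ' f)‖ₑ
  rw [cutoff_magTranslation hQ hQ' b R h]
  have := congrArg (fun T : L2 →L[ℂ] L2 => T (cutoff Q' hQ' f)) hT.eq
  change T (magTranslation b R _) = magTranslation b R (T _) at this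
  rw [this, enorm_magTranslation]

/-! ### The trace property -/

/-- The cell of side `L` with lower left corner `L • k - (L / 2, L / 2)`. -/
def cell (L : ℝ) (k : ℤ × ℤ) : Set (ℝ × ℝ) :=
  Set.Ico (-L / 2 + k.1 • L) (-L / 2 + (k.1 + 1) • L) ×ˢ
    Set.Ico (-L / 2 + k.2 • L) (-L / 2 + (k.2 + 1) • L)

theorem measurableSet_cell (L : ℝ) (k : ℤ × ℤ) : MeasurableSet (cell L k) :=
  measurableSet_Ico.prod measurableSet_Ico

theorem iUnion_cell {L : ℝ} (hL : 0 < L) : ⋃ k, cell L k = Set.univ := by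
  refine Set.eq_univ_of_forall fun x => ?_
  have h := iUnion_Ico_add_zsmul hL (-L / 2)
  obtain ⟨i, hi⟩ := Set.mem_iUnion.1 (h ▸ Set.mem_univ x.1)
  obtain ⟨j, hj⟩ := Set.mem_iUnion.1 (h ▸ Set.mem_univ x.2)
  exact Set.mem_iUnion.2 ⟨(i, j), hi, hj⟩

theorem pairwise_disjoint_cell (L : ℝ) : Pairwise (Function.onFun Disjoint (cell L)) := by
  intro k l hkl
  have h := Set.pairwise_disjoint_Ico_add_zsmul (-L / 2) L
  rw [Function.onFun, cell, cell, Set.disjoint_prod]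
  by_cases h1 : k.1 = l.1
  · exact Or.inr (h fun h2 => hkl (Prod.ext h1 h2))
  · exact Or.inl (h h1)

theorem mem_cell_iff (L : ℝ) (k : ℤ × ℤ) (x : ℝ × ℝ) :
    x ∈ cell L k ↔ x - (k.1 • L, k.2 • L) ∈ cell L 0 := by
  simp only [cell, Set.mem_prod, Set.mem_Ico, Prod.fst_sub, Prod.snd_sub, zsmul_eq_mul]
  push_cast
  constructor <;> rintro ⟨⟨h1, h2⟩, h3, h4⟩ <;> simp at * <;> refine ⟨⟨?_, ?_⟩, ?_, ?_⟩ <;> linarith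

/-- Half-open cells tile the plane exactly, whereas the trace per unit surface uses closed squares;
the difference is a null set. -/
theorem square_ae_eq_cell (L : ℝ) : square L =ᵐ[volume] cell L 0 := by
  have h : (-L / 2 + ((0 : ℤ) + 1) • L) = L / 2 := by simp; ring
  rw [square, cell, Prod.fst_zero, Prod.snd_zero, h, zero_smul, add_zero, Measure.volume_eq_prod]
  exact Measure.set_prod_ae_eq Ico_ae_eq_Icc.symm Ico_ae_eq_Icc.symm

theorem tsum_enorm_cutoff_cell {L : ℝ} (hL : 0 < L) (f : L2) :
    ∑' k, ‖cutoff (cell L k) (measurableSet_cell L k) f‖ₑ ^ 2 = ‖f‖ₑ ^ 2 := by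
  simp_rw [enorm_cutoff_sq]
  rw [← lintegral_iUnion (measurableSet_cell L) (pairwise_disjoint_cell L), iUnion_cell hL,
    setLIntegral_univ, enorm_sq_eq_lintegral]

theorem tsum_hsNormSq_cutoff_cell {L : ℝ} (hL : 0 < L) (T : L2 →L[ℂ] L2) :
    ∑' k, hsNormSq (cutoff (cell L k) (measurableSet_cell L k) * T) = hsNormSq T := by
  simp only [hsNormSq]
  rw [ENNReal.tsum_comm]
  exact tsum_congr fun i => tsum_enorm_cutoff_cell hL _

/-- Traciality of the trace per unit surface on operators commuting with the magnetic
translations. -/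
theorem hsNormSq_cell_adjoint {b L : ℝ} (hL : 0 < L) {T : L2 →L[ℂ] L2}
    (hT : ∀ R, Commute T (magTranslation b R)) :
    hsNormSq (ContinuousLinearMap.adjoint T * cutoff (cell L 0) (measurableSet_cell L 0)) =
      hsNormSq (T * cutoff (cell L 0) (measurableSet_cell L 0)) := by
  -- Both sides are split over the cells. The adjoint exchanges the two cutoffs and turns the term
  -- `1_{-k} T* 1_0` into `1_0 T 1_{-k}`; translation by `k L` turns this into `1_k T 1_0`. Hence
  -- the reindexing `k ↦ -k`.
  rw [← tsum_hsNormSq_cutoff_cell hL, ← tsum_hsNormSq_cutoff_cell hL (T * _)]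
  rw [← (Equiv.neg (ℤ × ℤ)).tsum_eq]
  refine tsum_congr fun k => ?_
  rw [← hsNormSq_adjoint]
  have e : ContinuousLinearMap.adjoint (cutoff (cell L (-k)) (measurableSet_cell L (-k)) *
      (ContinuousLinearMap.adjoint T * cutoff (cell L 0) (measurableSet_cell L 0))) =
      cutoff (cell L 0) (measurableSet_cell L 0) * T *
        cutoff (cell L (-k)) (measurableSet_cell L (-k)) := by
    change ContinuousLinearMap.adjoint (_ ∘L (_ ∘L _)) = _
    rw [ContinuousLinearMap.adjoint_comp, ContinuousLinearMap.adjoint_comp,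
      ContinuousLinearMap.adjoint_adjoint, isSelfAdjoint_cutoff, isSelfAdjoint_cutoff]
    rfl
  simp only [Equiv.neg_apply]
  rw [e]
  set R : ℝ × ℝ := (k.1 • L, k.2 • L) with hR
  rw [← hsNormSq_mul_of_isometry_adjoint (_ * (T * _)) (enorm_adjoint_magTranslation b R)]
  refine hsNormSq_congr fun f => ?_
  rw [mul_assoc]
  simp only [mul_apply_eq_comp]
  have hm : ∀ g, T (magTranslation b R g) = magTranslation b R (T g) := fun g =>
    congrArg (fun T : L2 →L[ℂ] L2 => T g) (hT R).eq
  rw [cutoff_magTranslation (measurableSet_cell L 0) (measurableSet_cell L (-k)) b R, hm,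
    cutoff_magTranslation (measurableSet_cell L k) (measurableSet_cell L 0) b R,
    enorm_magTranslation]
  · exact fun x => mem_cell_iff L k x
  · intro x
    rw [mem_cell_iff L (-k)]
    simp [hR, sub_eq_add_neg, add_assoc, Prod.mk_zero_zero]

/-! ### Functions of the form `exp (-q) φ` -/

theorem _root_.Function.HasTemperateGrowth.fderiv {E F : Type*} [NormedAddCommGroup E]
    [NormedSpace ℝ E] [NormedAddCommGroup F] [NormedSpace ℝ F] {f : E → F}
    (hf : f.HasTemperateGrowth) : (fderiv ℝ f).HasTemperateGrowth := by
  refine ⟨hf.1.fderiv_right (m := ∞) (by simp), fun n => ?_⟩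
  obtain ⟨k, C, h⟩ := hf.2 (n + 1)
  exact ⟨k, C, fun x => norm_iteratedFDeriv_fderiv (𝕜 := ℝ) (f := f) ▸ h x⟩

theorem hasTemperateGrowth_cexp_mul_I (c : ℝ) :
    (fun t : ℝ => Complex.exp (c * t * Complex.I)).HasTemperateGrowth := by
  refine ⟨?_, fun n => ⟨0, |c| ^ n, fun t => ?_⟩⟩
  · exact ((contDiff_const.mul Complex.ofRealCLM.contDiff).mul contDiff_const).cexp
  rw [norm_iteratedFDeriv_eq_norm_iteratedDeriv]
  have h : iteratedDeriv n (fun t : ℝ => Complex.exp (c * t * Complex.I)) =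
      fun t : ℝ => (c * Complex.I) ^ n * Complex.exp (c * t * Complex.I) := by
    induction n with
    | zero => simp
    | succ n ih =>
      rw [iteratedDeriv_succ, ih]
      ext t
      have h1 : HasDerivAt (fun t : ℝ => (c : ℂ) * t * Complex.I) (c * Complex.I) t := by
        simpa using ((Complex.ofRealCLM.hasDerivAt (x := t)).const_mul (c : ℂ)).mul_const Complex.I
      rw [(h1.cexp.const_mul _).deriv]
      ring
  have h2 : ‖Complex.exp (c * t * Complex.I)‖ = 1 := by
    exact_mod_cast Complex.norm_exp_ofReal_mul_I (c * t)
  rw [h]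
  simp [h2]

theorem pow_mul_exp_neg_mul_sq_le {δ : ℝ} (hδ : 0 < δ) (k : ℕ) :
    ∃ C : ℝ, ∀ r : ℝ, 0 ≤ r → (1 + r) ^ k * Real.exp (-(δ * r ^ 2)) ≤ C := by
  refine ⟨k.factorial * Real.exp (1 + 1 / (4 * δ)), fun r hr => ?_⟩
  have h1 := Real.pow_div_factorial_le_exp (1 + r) (by linarith) k
  rw [div_le_iff₀ (by positivity)] at h1
  have h2 : 1 + r - δ * r ^ 2 ≤ 1 + 1 / (4 * δ) := by
    have : 1 / (4 * δ) - r + δ * r ^ 2 = δ * (r - 1 / (2 * δ)) ^ 2 := by field_simp; ring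
    nlinarith [mul_nonneg hδ.le (sq_nonneg (r - 1 / (2 * δ)))]
  calc (1 + r) ^ k * Real.exp (-(δ * r ^ 2))
      ≤ Real.exp (1 + r) * k.factorial * Real.exp (-(δ * r ^ 2)) := by gcongr
    _ = k.factorial * Real.exp (1 + r - δ * r ^ 2) := by
      rw [sub_eq_add_neg, Real.exp_add (1 + r)]; ring
    _ ≤ _ := by gcongr

/-- The derivative of `e^{-q} φ` is `e^{-q} (φ' - q' φ)`, of the same shape but with values in `E
→L[ℝ] F`. The induction on the order of differentiation therefore keeps the target space and `φ`
arbitrary; order zero is Gaussian decay against polynomial growth. -/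
theorem decay_cexp_neg_smul {E : Type} [NormedAddCommGroup E] [NormedSpace ℝ E] {q : E → ℂ}
    (hq : q.HasTemperateGrowth) {δ : ℝ} (hδ : 0 < δ) (h : ∀ x, δ * ‖x‖ ^ 2 ≤ (q x).re) (n : ℕ) :
    ∀ {F : Type} [NormedAddCommGroup F] [NormedSpace ℂ F] {φ : E → F}, φ.HasTemperateGrowth →
      ∀ k : ℕ, ∃ C : ℝ, ∀ x,
        ‖x‖ ^ k * ‖iteratedFDeriv ℝ n (fun x => Complex.exp (-q x) • φ x) x‖ ≤ C := by
  induction n with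
  | zero =>
    intro F _ _ φ hφ k
    obtain ⟨l, D, hD⟩ := hφ.2 0
    obtain ⟨C, hC⟩ := pow_mul_exp_neg_mul_sq_le hδ (k + l)
    refine ⟨|D| * C, fun x => ?_⟩
    simp only [norm_iteratedFDeriv_zero] at hD ⊢
    rw [norm_smul, Complex.norm_exp, Complex.neg_re]
    have hx := norm_nonneg x
    calc ‖x‖ ^ k * (Real.exp (-(q x).re) * ‖φ x‖)
        ≤ (1 + ‖x‖) ^ k * (Real.exp (-(δ * ‖x‖ ^ 2)) * (|D| * (1 + ‖x‖) ^ l)) := by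
          gcongr
          · linarith
          · exact h x
          · exact (hD x).trans (by gcongr; exact le_abs_self D)
      _ = |D| * ((1 + ‖x‖) ^ (k + l) * Real.exp (-(δ * ‖x‖ ^ 2))) := by ring
      _ ≤ |D| * C := by gcongr; exact hC _ hx
  | succ n ih =>
    intro F _ _ φ hφ k
    -- `B ℓ y` is the map `v ↦ ℓ v • y`, so that `q' φ` is a bilinear expression of temperate
    -- growth.
    let B : (E →L[ℝ] ℂ) →L[ℝ] F →L[ℝ] (E →L[ℝ] F) :=
      ((ContinuousLinearMap.compL ℝ E ℂ F) ∘L (ContinuousLinearMap.lsmul ℝ ℂ).flip).flip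
    have hf : fderiv ℝ (fun x => Complex.exp (-q x) • φ x) =
        fun x => Complex.exp (-q x) • (fderiv ℝ φ x - B (fderiv ℝ q x) (φ x)) := by
      ext x v
      have h1 : HasFDerivAt q (fderiv ℝ q x) x := (hq.1.differentiable (by simp) x).hasFDerivAt
      have h2 : HasFDerivAt φ (fderiv ℝ φ x) x := (hφ.1.differentiable (by simp) x).hasFDerivAt
      rw [(h1.fun_neg.cexp.fun_smul h2).fderiv]
      simp [B, smul_smul, sub_eq_add_neg]
    obtain ⟨C, hC⟩ := ih (F := E →L[ℝ] F) (φ := fun x => fderiv ℝ φ x - B (fderiv ℝ q x) (φ x))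
      (hφ.fderiv.sub (B.bilinear_hasTemperateGrowth hq.fderiv hφ)) k
    refine ⟨C, fun x => ?_⟩
    rw [← norm_iteratedFDeriv_fderiv, hf]
    exact hC x

/-! ### Operators on Schwartz functions -/

/-- Schwartz functions on the plane. -/
abbrev Sch : Type := SchwartzMap (ℝ × ℝ) ℂ

/-- The class in `L²(ℝ²)` of a Schwartz function. -/
abbrev Sch.toL2 (φ : Sch) : L2 := φ.toLp 2 volume

theorem Sch.toL2_add (φ χ : Sch) : (φ + χ).toL2 = φ.toL2 + χ.toL2 :=
  map_add (SchwartzMap.toLpCLM ℂ ℂ 2 (volume : Measure (ℝ × ℝ))) φ χ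

theorem Sch.toL2_sub (φ χ : Sch) : (φ - χ).toL2 = φ.toL2 - χ.toL2 :=
  map_sub (SchwartzMap.toLpCLM ℂ ℂ 2 (volume : Measure (ℝ × ℝ))) φ χ

theorem Sch.toL2_smul (c : ℂ) (φ : Sch) : (c • φ).toL2 = c • φ.toL2 :=
  map_smul (SchwartzMap.toLpCLM ℂ ℂ 2 (volume : Measure (ℝ × ℝ))) c φ

theorem Sch.toL2_zero : (0 : Sch).toL2 = 0 :=
  map_zero (SchwartzMap.toLpCLM ℂ ℂ 2 (volume : Measure (ℝ × ℝ)))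

theorem hasTemperateGrowth_ofReal_clm (a : ℝ × ℝ →L[ℝ] ℝ) :
    (fun x => (a x : ℂ)).HasTemperateGrowth :=
  (Complex.ofRealCLM.comp a).hasTemperateGrowth

/-- Multiplication of Schwartz functions by a real linear form. -/
def mulLin (a : ℝ × ℝ →L[ℝ] ℝ) : Module.End ℂ Sch :=
  (SchwartzMap.smulLeftCLM ℂ (fun x => (a x : ℂ))).toLinearMap

theorem mulLin_apply (a : ℝ × ℝ →L[ℝ] ℝ) (φ : Sch) (x : ℝ × ℝ) : mulLin a φ x = a x * φ x :=
  SchwartzMap.smulLeftCLM_apply_apply (hasTemperateGrowth_ofReal_clm a) φ x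

/-- Directional derivative of Schwartz functions. -/
def dirDeriv (e : ℝ × ℝ) : Module.End ℂ Sch :=
  (LineDeriv.lineDerivOpCLM ℂ Sch e).toLinearMap

theorem dirDeriv_apply (e : ℝ × ℝ) (φ : Sch) (x : ℝ × ℝ) : dirDeriv e φ x = fderiv ℝ φ x e :=
  SchwartzMap.lineDerivOp_apply_eq_fderiv e φ x

/-- The momentum `-i ∂_e + a` on Schwartz functions, for a real linear form `a`. -/
def momentum (e : ℝ × ℝ) (a : ℝ × ℝ →L[ℝ] ℝ) : Module.End ℂ Sch :=
  (-Complex.I) • dirDeriv e + mulLin a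

theorem momentum_apply (e : ℝ × ℝ) (a : ℝ × ℝ →L[ℝ] ℝ) (φ : Sch) (x : ℝ × ℝ) :
    momentum e a φ x = -Complex.I * fderiv ℝ φ x e + a x * φ x := by
  simp [momentum, mulLin_apply, dirDeriv_apply]

theorem mulLin_mulLin_comm (a a' : ℝ × ℝ →L[ℝ] ℝ) (φ : Sch) :
    mulLin a (mulLin a' φ) = mulLin a' (mulLin a φ) := by
  ext x
  simp [mulLin_apply, mul_left_comm]

theorem dirDeriv_dirDeriv_comm (e e' : ℝ × ℝ) (φ : Sch) :
    dirDeriv e (dirDeriv e' φ) = dirDeriv e' (dirDeriv e φ) := by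
  ext x
  have key : ∀ e e' : ℝ × ℝ, dirDeriv e (dirDeriv e' φ) x =
      fderiv ℝ (fderiv ℝ φ) x e e' := by
    intro e e'
    rw [dirDeriv_apply]
    have : ⇑(dirDeriv e' φ) = fun y => fderiv ℝ φ y e' := funext fun y => dirDeriv_apply e' φ y
    rw [this, fderiv_clm_apply ((φ.smooth 2).fderiv_right (m := 1) (by norm_num) |>.differentiable
      (by norm_num) x) (differentiableAt_const _)]
    simp
  have hs : IsSymmSndFDerivAt ℝ φ x :=
    (φ.smooth 2).contDiffAt.isSymmSndFDerivAt (by simp)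
  rw [key, key, hs.eq e e']

theorem dirDeriv_mulLin (e : ℝ × ℝ) (a : ℝ × ℝ →L[ℝ] ℝ) (φ : Sch) :
    dirDeriv e (mulLin a φ) = mulLin a (dirDeriv e φ) + (a e : ℂ) • φ := by
  ext x
  have h1 : ⇑(mulLin a φ) = fun y => (a y : ℂ) * φ y := funext fun y => mulLin_apply a φ y
  have h2 : HasFDerivAt (fun y => (a y : ℂ)) (Complex.ofRealCLM.comp a) x :=
    (Complex.ofRealCLM.comp a).hasFDerivAt
  have h3 := (h2.fun_mul (φ.hasFDerivAt x)).fderiv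
  simp only [add_apply, smul_apply, mulLin_apply]
  rw [dirDeriv_apply, h1, h3, dirDeriv_apply]
  simp
  ring

/-- The commutator is the scalar `-i (a' e - a e')`; every commutation relation between kinetic
momenta and pseudo-momenta is an instance. -/
theorem momentum_momentum (e e' : ℝ × ℝ) (a a' : ℝ × ℝ →L[ℝ] ℝ) (φ : Sch) :
    momentum e a (momentum e' a' φ) = momentum e' a' (momentum e a φ) +
      (-Complex.I * ((a' e : ℂ) - a e')) • φ := by
  simp only [momentum, LinearMap.add_apply, LinearMap.smul_apply, map_add, map_smul,
    dirDeriv_mulLin, dirDeriv_dirDeriv_comm e e', mulLin_mulLin_comm a a']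
  module

theorem inner_toL2 (φ χ : Sch) :
    inner ℂ φ.toL2 χ.toL2 = ∫ x, starRingEnd ℂ (φ x) * χ x := by
  rw [L2.inner_def]
  refine integral_congr_ae ?_
  filter_upwards [φ.coeFn_toLp 2 volume, χ.coeFn_toLp 2 volume] with x h1 h2
  rw [h1, h2, RCLike.inner_apply, mul_comm]

/-- Complex conjugation of Schwartz functions. -/
def conjSch (φ : Sch) : Sch := φ.postcompCLM (𝕜 := ℝ) Complex.conjCLE.toContinuousLinearMap

theorem conjSch_apply (φ : Sch) (x : ℝ × ℝ) : conjSch φ x = starRingEnd ℂ (φ x) := rfl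

theorem fderiv_conjSch (φ : Sch) (x e : ℝ × ℝ) :
    fderiv ℝ (conjSch φ) x e = starRingEnd ℂ (fderiv ℝ φ x e) := by
  have h : HasFDerivAt (conjSch φ) (Complex.conjCLE.toContinuousLinearMap.comp (fderiv ℝ φ x)) x :=
    Complex.conjCLE.toContinuousLinearMap.hasFDerivAt.comp x (φ.hasFDerivAt x)
  rw [h.fderiv]
  rfl

theorem inner_momentum_toL2 (e : ℝ × ℝ) (a : ℝ × ℝ →L[ℝ] ℝ) (φ χ : Sch) :
    inner ℂ (momentum e a φ).toL2 χ.toL2 = inner ℂ φ.toL2 (momentum e a χ).toL2 := by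
  have hd : inner ℂ (dirDeriv e φ).toL2 χ.toL2 = -inner ℂ φ.toL2 (dirDeriv e χ).toL2 := by
    have h := SchwartzMap.integral_mul_lineDerivOp_right_eq_neg_left
      (μ := (volume : Measure (ℝ × ℝ))) (conjSch φ) χ e
    rw [inner_toL2, inner_toL2]
    simp only [SchwartzMap.lineDerivOp_apply_eq_fderiv, conjSch_apply, fderiv_conjSch] at h
    simp only [dirDeriv_apply]
    rw [h, neg_neg]
  have hm : inner ℂ (mulLin a φ).toL2 χ.toL2 = inner ℂ φ.toL2 (mulLin a χ).toL2 := by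
    rw [inner_toL2, inner_toL2]
    refine integral_congr_ae (Eventually.of_forall fun x => ?_)
    simp [mulLin_apply]
    ring
  simp only [momentum, LinearMap.add_apply, LinearMap.smul_apply, Sch.toL2_add, Sch.toL2_smul,
    inner_add_left, inner_add_right, inner_smul_left, inner_smul_right, hd, hm]
  simp

/-! ### Magnetic translations of Schwartz functions -/

theorem hasTemperateGrowth_magPhase (b : ℝ) (R : ℝ × ℝ) : (fun x : ℝ × ℝ =>
    Complex.exp (-Complex.I * ((b * R.1 * x.2 : ℝ) : ℂ))).HasTemperateGrowth := by
  have h := (hasTemperateGrowth_cexp_mul_I (-(b * R.1))).comp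
    (ContinuousLinearMap.snd ℝ ℝ ℝ).hasTemperateGrowth
  convert h using 2 with x
  simp
  ring_nf

/-- The magnetic translation of a Schwartz function. -/
def magSch (b : ℝ) (R : ℝ × ℝ) (φ : Sch) : Sch :=
  SchwartzMap.smulLeftCLM ℂ (fun x : ℝ × ℝ => Complex.exp (-Complex.I * ((b * R.1 * x.2 : ℝ) : ℂ)))
    (SchwartzMap.compSubConstCLM ℂ R φ)

theorem magSch_apply (b : ℝ) (R : ℝ × ℝ) (φ : Sch) (x : ℝ × ℝ) :
    magSch b R φ x = magFun b R φ x := by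
  rw [magSch, SchwartzMap.smulLeftCLM_apply_apply (hasTemperateGrowth_magPhase b R)]
  rfl

theorem magTranslation_toL2 (b : ℝ) (R : ℝ × ℝ) (φ : Sch) :
    magTranslation b R φ.toL2 = (magSch b R φ).toL2 := by
  refine Lp.ext ?_
  have h := (measurePreserving_sub_right (volume : Measure (ℝ × ℝ)) R)
    |>.quasiMeasurePreserving.ae (φ.coeFn_toLp 2 volume)
  filter_upwards [coeFn_magTranslation b R φ.toL2, (magSch b R φ).coeFn_toLp 2 volume, h]
    with x h1 h2 h3
  rw [h1, h2, magSch_apply, magFun, magFun, h3]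

/-- Differentiating the phase contributes `-b R₁ e₂`, while moving `a` past the shift contributes `a
R`. The hypothesis says that these cancel, as they do for both kinetic momenta. -/
theorem momentum_magSch (b : ℝ) (R e : ℝ × ℝ) (a : ℝ × ℝ →L[ℝ] ℝ) (h : a R = b * R.1 * e.2)
    (φ : Sch) : momentum e a (magSch b R φ) = magSch b R (momentum e a φ) := by
  ext x
  have h1 : HasFDerivAt (fun x : ℝ × ℝ => Complex.exp (-Complex.I * ((b * R.1 * x.2 : ℝ) : ℂ)))
      (Complex.exp (-Complex.I * ((b * R.1 * x.2 : ℝ) : ℂ)) •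
        (-Complex.I) • ((b * R.1 : ℝ) : ℂ) • Complex.ofRealCLM.comp (ContinuousLinearMap.snd ℝ ℝ ℝ)) x := by
    have := ((Complex.ofRealCLM.comp (ContinuousLinearMap.snd ℝ ℝ ℝ)).hasFDerivAt (x := x)).const_mul
      ((b * R.1 : ℝ) : ℂ) |>.const_mul (-Complex.I) |>.cexp
    have hf : (fun x : ℝ × ℝ => Complex.exp (-Complex.I * ((b * R.1 * x.2 : ℝ) : ℂ))) = fun x =>
        Complex.exp (-Complex.I * (((b * R.1 : ℝ) : ℂ) *
          (Complex.ofRealCLM.comp (ContinuousLinearMap.snd ℝ ℝ ℝ)) x)) := by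
      ext y
      simp
    rw [hf, show Complex.exp (-Complex.I * ((b * R.1 * x.2 : ℝ) : ℂ)) = _ from congrFun hf x]
    exact this
  have h2 : HasFDerivAt (fun x => φ (x - R)) (fderiv ℝ φ (x - R)) x := by
    exact (φ.hasFDerivAt (x - R)).comp x ((hasFDerivAt_id x).sub_const R)
  have h3 : ⇑(magSch b R φ) = fun x => Complex.exp (-Complex.I * ((b * R.1 * x.2 : ℝ) : ℂ)) *
    φ (x - R) := funext fun x => magSch_apply b R φ x
  rw [momentum_apply, magSch_apply, magSch_apply, magFun, magFun, momentum_apply, h3,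
    (h1.fun_mul h2).fderiv, map_sub a, h]
  simp
  ring_nf
  simp
  ring

/-! ### Ladder operators -/

/-- The kinetic momentum `p₁`. -/
def kin1 : Module.End ℂ Sch := momentum (1, 0) 0

/-- The kinetic momentum `p₂ + b x₁`. -/
def kin2 (b : ℝ) : Module.End ℂ Sch := momentum (0, 1) (b • ContinuousLinearMap.fst ℝ ℝ ℝ)

/-- The pseudo-momentum `p₁ + b x₂`. -/
def pse1 (b : ℝ) : Module.End ℂ Sch := momentum (1, 0) (b • ContinuousLinearMap.snd ℝ ℝ ℝ)

/-- The pseudo-momentum `p₂`. -/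
def pse2 : Module.End ℂ Sch := momentum (0, 1) 0

/-- The normalisation `(2 b)^{-1/2}` of the ladder operators. -/
def ladderNorm (b : ℝ) : ℂ := ((√(2 * b))⁻¹ : ℝ)

theorem ladderNorm_mul_self {b : ℝ} (hb : 0 < b) : ladderNorm b * ladderNorm b * (2 * b) = 1 := by
  rw [ladderNorm]
  norm_cast
  rw [← mul_inv, Real.mul_self_sqrt (by positivity)]
  field_simp

theorem conj_ladderNorm (b : ℝ) : starRingEnd ℂ (ladderNorm b) = ladderNorm b :=
  Complex.conj_ofReal _

/-- The operator lowering the Landau level. -/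
def lower (b : ℝ) : Module.End ℂ Sch := ladderNorm b • (kin1 - Complex.I • kin2 b)

/-- The operator raising the Landau level. -/
def raise (b : ℝ) : Module.End ℂ Sch := ladderNorm b • (kin1 + Complex.I • kin2 b)

/-- The lowering operator inside a Landau level. -/
def lowerDeg (b : ℝ) : Module.End ℂ Sch := ladderNorm b • (pse1 b + Complex.I • pse2)

/-- The raising operator inside a Landau level. -/
def raiseDeg (b : ℝ) : Module.End ℂ Sch := ladderNorm b • (pse1 b - Complex.I • pse2)

theorem kin1_kin2 (b : ℝ) (φ : Sch) :
    kin1 (kin2 b φ) = kin2 b (kin1 φ) - (Complex.I * b) • φ := by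
  rw [kin1, kin2, momentum_momentum]
  simp [sub_eq_add_neg]

theorem pse1_pse2 (b : ℝ) (φ : Sch) :
    pse1 b (pse2 φ) = pse2 (pse1 b φ) + (Complex.I * b) • φ := by
  rw [pse1, pse2, momentum_momentum]
  simp

theorem kin1_pse1 (b : ℝ) (φ : Sch) : kin1 (pse1 b φ) = pse1 b (kin1 φ) := by
  rw [kin1, pse1, momentum_momentum]
  simp

theorem kin1_pse2 (φ : Sch) : kin1 (pse2 φ) = pse2 (kin1 φ) := by
  rw [kin1, pse2, momentum_momentum]
  simp

theorem kin2_pse1 (b : ℝ) (φ : Sch) : kin2 b (pse1 b φ) = pse1 b (kin2 b φ) := by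
  rw [kin2, pse1, momentum_momentum]
  simp

theorem kin2_pse2 (b : ℝ) (φ : Sch) : kin2 b (pse2 φ) = pse2 (kin2 b φ) := by
  rw [kin2, pse2, momentum_momentum]
  simp

theorem lower_raise {b : ℝ} (hb : 0 < b) (φ : Sch) :
    lower b (raise b φ) = raise b (lower b φ) + φ := by
  refine Eq.trans (b := raise b (lower b φ) + (ladderNorm b * ladderNorm b * (2 * b)) • φ) ?_
    (by rw [ladderNorm_mul_self hb, one_smul])
  simp only [lower, raise, LinearMap.smul_apply, LinearMap.sub_apply, LinearMap.add_apply, map_add,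
    map_sub, map_smul, kin1_kin2]
  match_scalars <;>
    first | ring1 | linear_combination (-2 * ladderNorm b ^ 2 * b) * Complex.I_sq

theorem lowerDeg_raiseDeg {b : ℝ} (hb : 0 < b) (φ : Sch) :
    lowerDeg b (raiseDeg b φ) = raiseDeg b (lowerDeg b φ) + φ := by
  refine Eq.trans (b := raiseDeg b (lowerDeg b φ) + (ladderNorm b * ladderNorm b * (2 * b)) • φ) ?_
    (by rw [ladderNorm_mul_self hb, one_smul])
  simp only [lowerDeg, raiseDeg, LinearMap.smul_apply, LinearMap.sub_apply, LinearMap.add_apply,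
    map_add, map_sub, map_smul, pse1_pse2]
  match_scalars <;>
    first | ring1 | linear_combination (-2 * ladderNorm b ^ 2 * b) * Complex.I_sq

theorem commute_raise_lowerDeg (b : ℝ) : Commute (raise b) (lowerDeg b) := by
  refine LinearMap.ext fun φ => ?_
  simp only [Module.End.mul_apply, lowerDeg, raise, LinearMap.smul_apply, LinearMap.add_apply,
    map_add, map_smul, kin1_pse1, kin2_pse1, kin1_pse2, kin2_pse2]
  module

theorem commute_raise_raiseDeg (b : ℝ) : Commute (raise b) (raiseDeg b) := by
  refine LinearMap.ext fun φ => ?_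
  simp only [Module.End.mul_apply, raiseDeg, raise, LinearMap.smul_apply, LinearMap.add_apply,
    LinearMap.sub_apply, map_sub, map_add, map_smul, kin1_pse1, kin2_pse1, kin1_pse2, kin2_pse2]
  module

theorem commute_lower_raiseDeg (b : ℝ) : Commute (lower b) (raiseDeg b) := by
  refine LinearMap.ext fun φ => ?_
  simp only [Module.End.mul_apply, raiseDeg, lower, LinearMap.smul_apply,
    LinearMap.sub_apply, map_sub, map_smul, kin1_pse1, kin2_pse1, kin1_pse2, kin2_pse2]
  module

theorem inner_raise (b : ℝ) (φ χ : Sch) :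
    inner ℂ (raise b φ).toL2 χ.toL2 = inner ℂ φ.toL2 (lower b χ).toL2 := by
  simp only [raise, lower, kin1, kin2, LinearMap.smul_apply, LinearMap.add_apply,
    LinearMap.sub_apply, Sch.toL2_smul, Sch.toL2_add, Sch.toL2_sub, inner_smul_left,
    inner_smul_right, inner_add_left, inner_sub_right, inner_momentum_toL2, conj_ladderNorm,
    Complex.conj_I]
  ring

theorem inner_lower (b : ℝ) (φ χ : Sch) :
    inner ℂ (lower b φ).toL2 χ.toL2 = inner ℂ φ.toL2 (raise b χ).toL2 := by
  rw [← inner_conj_symm, ← inner_raise, inner_conj_symm]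

theorem inner_raiseDeg (b : ℝ) (φ χ : Sch) :
    inner ℂ (raiseDeg b φ).toL2 χ.toL2 = inner ℂ φ.toL2 (lowerDeg b χ).toL2 := by
  simp only [raiseDeg, lowerDeg, pse1, pse2, LinearMap.smul_apply, LinearMap.add_apply,
    LinearMap.sub_apply, Sch.toL2_smul, Sch.toL2_add, Sch.toL2_sub, inner_smul_left,
    inner_smul_right, inner_sub_left, inner_add_right, inner_momentum_toL2, conj_ladderNorm,
    Complex.conj_I]
  ring

theorem kin1_magSch (b : ℝ) (R : ℝ × ℝ) (φ : Sch) :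
    kin1 (magSch b R φ) = magSch b R (kin1 φ) :=
  momentum_magSch b R _ _ (by simp) φ

theorem kin2_magSch (b : ℝ) (R : ℝ × ℝ) (φ : Sch) :
    kin2 b (magSch b R φ) = magSch b R (kin2 b φ) :=
  momentum_magSch b R _ _ (by simp) φ

theorem lower_magSch (b : ℝ) (R : ℝ × ℝ) (φ : Sch) :
    lower b (magSch b R φ) = magSch b R (lower b φ) := by
  have h : ∀ φ χ : Sch, ∀ c : ℂ, magSch b R (c • (φ - Complex.I • χ)) =
      c • (magSch b R φ - Complex.I • magSch b R χ) := by
    intro φ χ c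
    simp [magSch]
  simp only [lower, LinearMap.smul_apply, LinearMap.sub_apply, kin1_magSch, kin2_magSch, h]

theorem raise_magSch (b : ℝ) (R : ℝ × ℝ) (φ : Sch) :
    raise b (magSch b R φ) = magSch b R (raise b φ) := by
  have h : ∀ φ χ : Sch, ∀ c : ℂ, magSch b R (c • (φ + Complex.I • χ)) =
      c • (magSch b R φ + Complex.I • magSch b R χ) := by
    intro φ χ c
    simp [magSch]
  simp only [raise, LinearMap.smul_apply, LinearMap.add_apply, kin1_magSch, kin2_magSch, h]

/-- The coordinates are differences of kinetic and pseudo-momenta, hence combinations of the four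
ladder operators. Multiplication by polynomials therefore preserves the span of the eigenfunctions,
which is what completeness needs. -/
theorem mulLin_fst_eq {b : ℝ} (hb : 0 < b) (φ : Sch) :
    mulLin (ContinuousLinearMap.fst ℝ ℝ ℝ) φ = (b : ℂ)⁻¹ • (kin2 b φ - pse2 φ) := by
  ext x
  have : (b : ℂ) ≠ 0 := by exact_mod_cast hb.ne'
  simp [kin2, pse2, momentum_apply, mulLin_apply]
  field_simp

theorem mulLin_snd_eq {b : ℝ} (hb : 0 < b) (φ : Sch) :
    mulLin (ContinuousLinearMap.snd ℝ ℝ ℝ) φ = (b : ℂ)⁻¹ • (pse1 b φ - kin1 φ) := by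
  ext x
  have : (b : ℂ) ≠ 0 := by exact_mod_cast hb.ne'
  simp [kin1, pse1, momentum_apply, mulLin_apply]
  field_simp

theorem sqrt_mul_ladderNorm {b : ℝ} (hb : 0 < b) :
    ((√(b / 2) : ℝ) : ℂ) * ladderNorm b * 2 = 1 := by
  rw [ladderNorm]
  norm_cast
  rw [show 2 * b = b / 2 * 2 ^ 2 by ring, Real.sqrt_mul (by positivity), Real.sqrt_sq (by norm_num)]
  have : √(b / 2) ≠ 0 := by positivity
  field_simp

theorem kin1_eq {b : ℝ} (hb : 0 < b) (φ : Sch) :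
    kin1 φ = ((√(b / 2) : ℝ) : ℂ) • (lower b φ + raise b φ) := by
  have h := sqrt_mul_ladderNorm hb
  simp only [lower, raise, LinearMap.smul_apply, LinearMap.sub_apply, LinearMap.add_apply]
  match_scalars
  · linear_combination -h
  · ring

theorem kin2_eq {b : ℝ} (hb : 0 < b) (φ : Sch) :
    kin2 b φ = (-Complex.I * ((√(b / 2) : ℝ) : ℂ)) • (raise b φ - lower b φ) := by
  have h := sqrt_mul_ladderNorm hb
  simp only [lower, raise, LinearMap.smul_apply, LinearMap.sub_apply, LinearMap.add_apply]
  match_scalars <;> first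
    | ring1
    | linear_combination 2 * ((√(b / 2) : ℝ) : ℂ) * ladderNorm b * Complex.I_sq - h

theorem pse1_eq {b : ℝ} (hb : 0 < b) (φ : Sch) :
    pse1 b φ = ((√(b / 2) : ℝ) : ℂ) • (lowerDeg b φ + raiseDeg b φ) := by
  have h := sqrt_mul_ladderNorm hb
  simp only [lowerDeg, raiseDeg, LinearMap.smul_apply, LinearMap.sub_apply, LinearMap.add_apply]
  match_scalars
  · linear_combination -h
  · ring

theorem pse2_eq {b : ℝ} (hb : 0 < b) (φ : Sch) :
    pse2 φ = (-Complex.I * ((√(b / 2) : ℝ) : ℂ)) • (lowerDeg b φ - raiseDeg b φ) := by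
  have h := sqrt_mul_ladderNorm hb
  simp only [lowerDeg, raiseDeg, LinearMap.smul_apply, LinearMap.sub_apply, LinearMap.add_apply]
  match_scalars <;> first
    | ring1
    | linear_combination 2 * ((√(b / 2) : ℝ) : ℂ) * ladderNorm b * Complex.I_sq - h

/-! ### The ground state -/

/-- The exponent of the ground state. -/
def groundExp (b : ℝ) (x : ℝ × ℝ) : ℂ :=
  ((b / 4 * (x.1 ^ 2 + x.2 ^ 2) : ℝ) : ℂ) + Complex.I * ((b / 2 * (x.1 * x.2) : ℝ) : ℂ)

theorem hasTemperateGrowth_groundExp (b : ℝ) : (groundExp b).HasTemperateGrowth := by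
  have h1 : (fun x : ℝ × ℝ => x.1).HasTemperateGrowth :=
    (ContinuousLinearMap.fst ℝ ℝ ℝ).hasTemperateGrowth
  have h2 : (fun x : ℝ × ℝ => x.2).HasTemperateGrowth :=
    (ContinuousLinearMap.snd ℝ ℝ ℝ).hasTemperateGrowth
  have hc : ∀ {f : ℝ × ℝ → ℝ}, f.HasTemperateGrowth →
      (fun x => (f x : ℂ)).HasTemperateGrowth := fun hf =>
    Complex.ofRealCLM.hasTemperateGrowth.comp hf
  refine Function.HasTemperateGrowth.add (f := fun x : ℝ × ℝ => _) (g := fun x : ℝ × ℝ => _)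
    (hc ?_) (Function.HasTemperateGrowth.mul (f := fun x : ℝ × ℝ => _) (g := fun x : ℝ × ℝ => _)
    (Function.HasTemperateGrowth.const _) (hc ?_))
  · exact (Function.HasTemperateGrowth.const _).mul ((h1.pow 2).add (h2.pow 2))
  · exact (Function.HasTemperateGrowth.const _).mul (h1.mul h2)

theorem groundExp_re (b : ℝ) (x : ℝ × ℝ) : (groundExp b x).re = b / 4 * (x.1 ^ 2 + x.2 ^ 2) := by
  simp only [groundExp, Complex.add_re, Complex.ofReal_re, Complex.mul_re, Complex.I_re,
    Complex.ofReal_im, zero_mul, mul_zero, sub_zero, add_zero]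

theorem groundExp_re_ge {b : ℝ} (hb : 0 < b) (x : ℝ × ℝ) :
    b / 4 * ‖x‖ ^ 2 ≤ (groundExp b x).re := by
  -- The norm on `ℝ × ℝ` is the sup norm, so this is an inequality and not an identity.
  have h : ‖x‖ ^ 2 ≤ x.1 ^ 2 + x.2 ^ 2 := by
    rw [Prod.norm_def, Real.norm_eq_abs, Real.norm_eq_abs]
    rcases max_cases |x.1| |x.2| with ⟨h, -⟩ | ⟨h, -⟩ <;> rw [h, sq_abs] <;> nlinarith [sq_nonneg x.1, sq_nonneg x.2]
  rw [groundExp_re]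
  gcongr

/-- The ground state `(b / 2π)^{1/2} e^{-b |x|² / 4 - i b x₁ x₂ / 2}`. -/
def ground {b : ℝ} (hb : 0 < b) : Sch where
  toFun x := Complex.exp (-groundExp b x) • ((√(b / (2 * Real.pi)) : ℝ) : ℂ)
  smooth' := ((hasTemperateGrowth_groundExp b).1.neg.cexp).smul contDiff_const
  decay' k n := decay_cexp_neg_smul (hasTemperateGrowth_groundExp b) (δ := b / 4) (by positivity)
    (groundExp_re_ge hb) n (Function.HasTemperateGrowth.const _) k

theorem ground_apply {b : ℝ} (hb : 0 < b) (x : ℝ × ℝ) :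
    ground hb x = Complex.exp (-groundExp b x) * ((√(b / (2 * Real.pi)) : ℝ) : ℂ) := rfl

theorem fderiv_ground {b : ℝ} (hb : 0 < b) (x e : ℝ × ℝ) :
    fderiv ℝ (ground hb) x e = -((b : ℂ) / 2 * (x.1 * e.1 + x.2 * e.2) +
      Complex.I * (b / 2) * (x.1 * e.2 + x.2 * e.1)) * ground hb x := by
  let c1 := Complex.ofRealCLM.comp (ContinuousLinearMap.fst ℝ ℝ ℝ)
  let c2 := Complex.ofRealCLM.comp (ContinuousLinearMap.snd ℝ ℝ ℝ)
  have h1 : HasFDerivAt c1 c1 x := c1.hasFDerivAt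
  have h2 : HasFDerivAt c2 c2 x := c2.hasFDerivAt
  have hq := (((h1.fun_mul h1).fun_add (h2.fun_mul h2)).const_mul ((b : ℂ) / 4)).fun_add
    (((h1.fun_mul h2).const_mul ((b : ℂ) / 2)).const_mul Complex.I)
  have h := (hq.fun_neg.cexp.mul_const ((√(b / (2 * Real.pi)) : ℝ) : ℂ))
  have e1 : ⇑(ground hb) = fun x => Complex.exp (-((b : ℂ) / 4 * (c1 x * c1 x + c2 x * c2 x) +
      Complex.I * ((b : ℂ) / 2 * (c1 x * c2 x)))) * ((√(b / (2 * Real.pi)) : ℝ) : ℂ) := by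
    ext y
    rw [ground_apply, groundExp]
    simp [c1, c2, sq]
  rw [e1, h.fderiv]
  simp [c1, c2]
  ring

theorem lower_ground {b : ℝ} (hb : 0 < b) : lower b (ground hb) = 0 := by
  ext x
  simp [lower, kin1, kin2, momentum_apply, fderiv_ground]
  right
  linear_combination (-b * ground hb x / 2) * (Complex.I * x.1) * Complex.I_sq

theorem lowerDeg_ground {b : ℝ} (hb : 0 < b) : lowerDeg b (ground hb) = 0 := by
  ext x
  simp [lowerDeg, pse1, pse2, momentum_apply, fderiv_ground]
  linear_combination (ladderNorm b * b * ground hb x / 2) * (2 * x.2 + Complex.I * x.1) * Complex.I_sq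

/-- Multiplication by `x₁ - i x₂`. -/
def mulConj : Module.End ℂ Sch :=
  mulLin (ContinuousLinearMap.fst ℝ ℝ ℝ) - Complex.I • mulLin (ContinuousLinearMap.snd ℝ ℝ ℝ)

theorem mulConj_apply (φ : Sch) (x : ℝ × ℝ) :
    mulConj φ x = ((x.1 : ℂ) - Complex.I * x.2) * φ x := by
  simp [mulConj, mulLin_apply]
  ring

/-- On the Gaussian, raising inside the level is multiplication by a multiple of `x₁ - i x₂`. It
also commutes with that multiplication, so iterating gives monomials in `x₁ - i x₂` times the
Gaussian. -/
theorem raiseDeg_ground {b : ℝ} (hb : 0 < b) :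
    raiseDeg b (ground hb) = (ladderNorm b * Complex.I * b) • mulConj (ground hb) := by
  ext x
  simp [raiseDeg, pse1, pse2, momentum_apply, fderiv_ground, mulConj_apply]
  linear_combination (ladderNorm b * b * ground hb x / 2) * (2 * x.2 - Complex.I * x.1) * Complex.I_sq

theorem commute_raiseDeg_mulConj (b : ℝ) : Commute (raiseDeg b) mulConj := by
  refine LinearMap.ext fun φ => ?_
  simp only [Module.End.mul_apply, mulConj, raiseDeg, pse1, pse2, momentum, LinearMap.smul_apply,
    LinearMap.sub_apply, LinearMap.add_apply, map_add, map_sub, map_smul, dirDeriv_mulLin,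
    mulLin_mulLin_comm _ (b • ContinuousLinearMap.snd ℝ ℝ ℝ)]
  simp [mulLin_mulLin_comm _ (0 : ℝ × ℝ →L[ℝ] ℝ)]
  match_scalars <;> ring_nf
  simp

theorem raiseDeg_pow_ground {b : ℝ} (hb : 0 < b) (m : ℕ) :
    (raiseDeg b ^ m) (ground hb) = (ladderNorm b * Complex.I * b) ^ m • (mulConj ^ m) (ground hb) := by
  induction m with
  | zero => simp
  | succ m ih =>
    have h := congrArg (fun T : Module.End ℂ Sch => T (ground hb))
      ((commute_raiseDeg_mulConj b).pow_right m).eq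
    simp only [Module.End.mul_apply] at h
    rw [pow_succ', Module.End.mul_apply, ih, map_smul, h, raiseDeg_ground hb, map_smul, smul_smul,
      ← pow_succ, pow_succ mulConj, Module.End.mul_apply]

theorem mulConj_pow_apply (m : ℕ) (φ : Sch) (x : ℝ × ℝ) :
    (mulConj ^ m) φ x = ((x.1 : ℂ) - Complex.I * x.2) ^ m * φ x := by
  induction m with
  | zero => simp
  | succ m ih => rw [pow_succ', Module.End.mul_apply, mulConj_apply, ih]; ring

/-! ### The joint eigenfunctions -/

theorem apply_pow_of_commutator {a c : Module.End ℂ Sch}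
    (h : ∀ φ, a (c φ) = c (a φ) + φ) {χ : Sch} (hχ : a χ = 0) (n : ℕ) :
    a ((c ^ (n + 1)) χ) = ((n + 1 : ℕ) : ℂ) • (c ^ n) χ := by
  induction n with
  | zero => simp [h, hχ]
  | succ n ih =>
    rw [pow_succ', Module.End.mul_apply, h, ih, map_smul, ← Module.End.mul_apply, ← pow_succ']
    push_cast
    module

/-- The eigenfunction in the Landau level `n` with degeneracy index `m`. -/
def psi {b : ℝ} (hb : 0 < b) (n m : ℕ) : Sch :=
  (((√(n.factorial) * √(m.factorial))⁻¹ : ℝ) : ℂ) •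
    (raise b ^ n) ((raiseDeg b ^ m) (ground hb))

theorem psi_zero_zero {b : ℝ} (hb : 0 < b) : psi hb 0 0 = ground hb := by
  simp [psi]

theorem sqrt_succ_mul_inv (n : ℕ) :
    (√((n + 1 : ℕ) : ℝ)) * (√((n + 1).factorial : ℝ))⁻¹ = (√(n.factorial : ℝ))⁻¹ := by
  rw [Nat.factorial_succ, Nat.cast_mul, Real.sqrt_mul (by positivity)]
  have h1 : √((n + 1 : ℕ) : ℝ) ≠ 0 := by positivity
  have h2 : √(n.factorial : ℝ) ≠ 0 := by positivity
  field_simp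

theorem succ_mul_inv_sqrt (n : ℕ) :
    ((n + 1 : ℕ) : ℝ) * (√((n + 1).factorial : ℝ))⁻¹ = √((n + 1 : ℕ) : ℝ) * (√(n.factorial : ℝ))⁻¹ := by
  rw [← sqrt_succ_mul_inv n, ← mul_assoc, Real.mul_self_sqrt (by positivity)]

theorem raise_psi {b : ℝ} (hb : 0 < b) (n m : ℕ) :
    raise b (psi hb n m) = ((√((n + 1 : ℕ) : ℝ) : ℝ) : ℂ) • psi hb (n + 1) m := by
  rw [psi, psi, map_smul, smul_smul, ← Module.End.mul_apply, ← pow_succ', ← Complex.ofReal_mul,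
    mul_inv, mul_inv, ← mul_assoc, sqrt_succ_mul_inv]

theorem raiseDeg_psi {b : ℝ} (hb : 0 < b) (n m : ℕ) :
    raiseDeg b (psi hb n m) = ((√((m + 1 : ℕ) : ℝ) : ℝ) : ℂ) • psi hb n (m + 1) := by
  rw [psi, psi, map_smul, smul_smul, ← Module.End.mul_apply,
    ((commute_raise_raiseDeg b).pow_left n).symm.eq, Module.End.mul_apply,
    ← Module.End.mul_apply (raiseDeg b), ← pow_succ', ← Complex.ofReal_mul,
    mul_inv, mul_inv, mul_left_comm, sqrt_succ_mul_inv]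

theorem lower_psi_zero {b : ℝ} (hb : 0 < b) (m : ℕ) : lower b (psi hb 0 m) = 0 := by
  rw [psi, map_smul, pow_zero, Module.End.one_apply, ← Module.End.mul_apply,
    ((commute_lower_raiseDeg b).pow_right m).eq, Module.End.mul_apply, lower_ground, map_zero,
    smul_zero]

theorem lower_psi_succ {b : ℝ} (hb : 0 < b) (n m : ℕ) :
    lower b (psi hb (n + 1) m) = ((√((n + 1 : ℕ) : ℝ) : ℝ) : ℂ) • psi hb n m := by
  have h0 : lower b ((raiseDeg b ^ m) (ground hb)) = 0 := by
    rw [← Module.End.mul_apply, ((commute_lower_raiseDeg b).pow_right m).eq, Module.End.mul_apply,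
      lower_ground, map_zero]
  rw [psi, psi, map_smul, apply_pow_of_commutator (lower_raise hb) h0, smul_smul,
    smul_smul, ← Complex.ofReal_natCast, ← Complex.ofReal_mul, ← Complex.ofReal_mul, mul_inv,
    mul_inv, ← mul_assoc, mul_comm, ← mul_assoc, succ_mul_inv_sqrt]

theorem lowerDeg_psi_zero {b : ℝ} (hb : 0 < b) (n : ℕ) : lowerDeg b (psi hb n 0) = 0 := by
  rw [psi, map_smul, pow_zero, Module.End.one_apply, ← Module.End.mul_apply,
    ((commute_raise_lowerDeg b).pow_left n).symm.eq, Module.End.mul_apply, lowerDeg_ground,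
    map_zero, smul_zero]

theorem lowerDeg_psi_succ {b : ℝ} (hb : 0 < b) (n m : ℕ) :
    lowerDeg b (psi hb n (m + 1)) = ((√((m + 1 : ℕ) : ℝ) : ℝ) : ℂ) • psi hb n m := by
  rw [psi, psi, map_smul, ← Module.End.mul_apply,
    ((commute_raise_lowerDeg b).pow_left n).symm.eq, Module.End.mul_apply,
    apply_pow_of_commutator (lowerDeg_raiseDeg hb) (lowerDeg_ground hb), map_smul,
    smul_smul, smul_smul, ← Complex.ofReal_natCast, ← Complex.ofReal_mul, ← Complex.ofReal_mul,
    mul_inv, mul_inv, mul_assoc, mul_comm (√((m + 1).factorial : ℝ))⁻¹, succ_mul_inv_sqrt,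
    mul_left_comm]

/-! ### Matrix elements and orthonormality -/

/-- The recursion moves along diagonals. Off the main diagonal it descends to a vanishing boundary
entry; on it the two square roots cancel and the entry stays constant. -/
theorem eq_ite_of_ladder (f : ℕ → ℕ → ℂ) (h0 : ∀ n, f 0 (n + 1) = 0) (h1 : ∀ n, f (n + 1) 0 = 0)
    (h : ∀ n n', (√((n + 1 : ℕ) : ℝ) : ℂ) * f (n + 1) (n' + 1) = (√((n' + 1 : ℕ) : ℝ) : ℂ) * f n n')
    (n n' : ℕ) : f n n' = if n = n' then f 0 0 else 0 := by
  induction n generalizing n' with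
  | zero => cases n' <;> simp [h0]
  | succ n ih =>
    cases n' with
    | zero => simp [h1]
    | succ n' =>
      have hn : (√((n + 1 : ℕ) : ℝ) : ℂ) ≠ 0 := by
        norm_cast; positivity
      have := h n n'
      rw [ih] at this
      by_cases e : n = n'
      · subst e
        simpa using mul_left_cancel₀ hn (by simpa using this)
      · simp only [e, if_false, mul_zero, mul_eq_zero, hn, false_or] at this
        simp [this, e]

/-- Operators commuting with the level ladder are diagonal in the Landau level and do not depend
on it. -/
theorem inner_psi_of_commute {b : ℝ} (hb : 0 < b) (T : L2 →L[ℂ] L2)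
    (h1 : ∀ φ χ : Sch, inner ℂ (raise b φ).toL2 (T χ.toL2) = inner ℂ φ.toL2 (T (lower b χ).toL2))
    (h2 : ∀ φ χ : Sch, inner ℂ (lower b φ).toL2 (T χ.toL2) = inner ℂ φ.toL2 (T (raise b χ).toL2))
    (n m n' m' : ℕ) :
    inner ℂ (psi hb n m).toL2 (T (psi hb n' m').toL2) =
      if n = n' then inner ℂ (psi hb 0 m).toL2 (T (psi hb 0 m').toL2) else 0 := by
  have hs : ∀ k : ℕ, ((√((k + 1 : ℕ) : ℝ) : ℝ) : ℂ) ≠ 0 := fun k => by norm_cast; positivity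
  refine eq_ite_of_ladder (fun n n' => inner ℂ (psi hb n m).toL2 (T (psi hb n' m').toL2))
    (fun k => ?_) (fun k => ?_) (fun k k' => ?_) n n'
  · have := h2 (psi hb 0 m) (psi hb k m')
    rw [lower_psi_zero, raise_psi, Sch.toL2_zero, inner_zero_left, Sch.toL2_smul, map_smul,
      inner_smul_right] at this
    exact (mul_eq_zero.1 this.symm).resolve_left (hs k)
  · have := h1 (psi hb k m) (psi hb 0 m')
    rw [lower_psi_zero, raise_psi, Sch.toL2_zero, map_zero, inner_zero_right, Sch.toL2_smul,
      inner_smul_left, Complex.conj_ofReal] at this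
    exact (mul_eq_zero.1 this).resolve_left (hs k)
  · have := h1 (psi hb k m) (psi hb (k' + 1) m')
    rwa [lower_psi_succ, raise_psi, Sch.toL2_smul, Sch.toL2_smul, map_smul, inner_smul_left,
      inner_smul_right, Complex.conj_ofReal] at this

theorem inner_psi_magTranslation {b : ℝ} (hb : 0 < b) (R : ℝ × ℝ) (n m n' m' : ℕ) :
    inner ℂ (psi hb n m).toL2 (magTranslation b R (psi hb n' m').toL2) =
      if n = n' then inner ℂ (psi hb 0 m).toL2 (magTranslation b R (psi hb 0 m').toL2) else 0 := by
  refine inner_psi_of_commute hb _ (fun φ χ => ?_) (fun φ χ => ?_) n m n' m'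
  · rw [magTranslation_toL2, magTranslation_toL2, inner_raise, lower_magSch]
  · rw [magTranslation_toL2, magTranslation_toL2, inner_lower, raise_magSch]

theorem norm_ground {b : ℝ} (hb : 0 < b) (x : ℝ × ℝ) :
    ‖ground hb x‖ = √(b / (2 * Real.pi)) * Real.exp (-(b / 4 * (x.1 ^ 2 + x.2 ^ 2))) := by
  rw [ground_apply, norm_mul, Complex.norm_exp, mul_comm, Complex.norm_real, Real.norm_of_nonneg
    (Real.sqrt_nonneg _), Complex.neg_re, groundExp_re]

theorem inner_ground_self {b : ℝ} (hb : 0 < b) :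
    inner ℂ (ground hb).toL2 (ground hb).toL2 = 1 := by
  rw [inner_toL2]
  have h : ∀ x : ℝ × ℝ, starRingEnd ℂ (ground hb x) * ground hb x =
      ((b / (2 * Real.pi) * (Real.exp (-(b / 2) * x.1 ^ 2) * Real.exp (-(b / 2) * x.2 ^ 2)) : ℝ) : ℂ) := by
    intro x
    rw [mul_comm, Complex.mul_conj, Complex.normSq_eq_norm_sq, norm_ground, mul_pow, Real.sq_sqrt
      (by positivity), ← Real.exp_nat_mul, ← Real.exp_add]
    congr 3
    push_cast
    ring
  simp_rw [h]
  rw [integral_complex_ofReal, integral_const_mul, Measure.volume_eq_prod,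
    integral_prod_mul (fun x : ℝ => Real.exp (-(b / 2) * x ^ 2))
      (fun x : ℝ => Real.exp (-(b / 2) * x ^ 2)), integral_gaussian,
    Real.mul_self_sqrt (by positivity)]
  norm_cast
  have := Real.pi_pos
  field_simp

theorem inner_psi_psi {b : ℝ} (hb : 0 < b) (n m n' m' : ℕ) :
    inner ℂ (psi hb n m).toL2 (psi hb n' m').toL2 = if n = n' ∧ m = m' then 1 else 0 := by
  have h1 := inner_psi_of_commute hb 1 (fun φ χ => inner_raise b φ χ)
    (fun φ χ => inner_lower b φ χ) n m n' m'
  simp only [one_apply_eq_self] at h1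
  have hs : ∀ k : ℕ, ((√((k + 1 : ℕ) : ℝ) : ℝ) : ℂ) ≠ 0 := fun k => by norm_cast; positivity
  have h2 : inner ℂ (psi hb 0 m).toL2 (psi hb 0 m').toL2 = if m = m' then 1 else 0 := by
    rw [← inner_ground_self hb, ← psi_zero_zero]
    refine eq_ite_of_ladder (fun m m' => inner ℂ (psi hb 0 m).toL2 (psi hb 0 m').toL2)
      (fun k => ?_) (fun k => ?_) (fun k k' => ?_) m m'
    · have := inner_raiseDeg b (psi hb 0 k) (psi hb 0 0)
      rw [lowerDeg_psi_zero, raiseDeg_psi, Sch.toL2_zero, inner_zero_right, Sch.toL2_smul,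
        inner_smul_left, Complex.conj_ofReal] at this
      rw [← inner_conj_symm, (mul_eq_zero.1 this).resolve_left (hs k), map_zero]
    · have := inner_raiseDeg b (psi hb 0 k) (psi hb 0 0)
      rw [lowerDeg_psi_zero, raiseDeg_psi, Sch.toL2_zero, inner_zero_right, Sch.toL2_smul,
        inner_smul_left, Complex.conj_ofReal] at this
      exact (mul_eq_zero.1 this).resolve_left (hs k)
    · have := inner_raiseDeg b (psi hb 0 k) (psi hb 0 (k' + 1))
      rwa [lowerDeg_psi_succ, raiseDeg_psi, Sch.toL2_smul, Sch.toL2_smul, inner_smul_left,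
        inner_smul_right, Complex.conj_ofReal] at this
  rw [h1, h2]
  split_ifs <;> simp_all

theorem orthonormal_psi {b : ℝ} (hb : 0 < b) :
    Orthonormal ℂ (fun p : ℕ × ℕ => (psi hb p.1 p.2).toL2) := by
  rw [orthonormal_iff_ite]
  intro p q
  rw [inner_psi_psi]
  simp [Prod.ext_iff]

/-! ### Completeness -/

/-- The positive and negative parts of `u` are densities of finite measures with the same
characteristic function, so the measures agree. -/
theorem ae_eq_zero_of_integral_cexp_eq_zero {u : ℝ × ℝ → ℝ} (hu : Integrable u)
    (h : ∀ a : StrongDual ℝ (ℝ × ℝ), ∫ x, Complex.exp (a x * Complex.I) * (u x : ℂ) = 0) :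
    u =ᵐ[volume] 0 := by
  have hp : Integrable (fun x => (u x)⁺) := hu.pos_part
  have hn : Integrable (fun x => (u x)⁻) := hu.neg_part
  let μ := (volume : Measure (ℝ × ℝ)).withDensity fun x => ENNReal.ofReal ((u x)⁺)
  let ν := (volume : Measure (ℝ × ℝ)).withDensity fun x => ENNReal.ofReal ((u x)⁻)
  have : IsFiniteMeasure μ := isFiniteMeasure_withDensity_ofReal hp.2
  have : IsFiniteMeasure ν := isFiniteMeasure_withDensity_ofReal hn.2
  have hb : ∀ {v : ℝ × ℝ → ℝ} (_ : Integrable v) (a : StrongDual ℝ (ℝ × ℝ)),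
      Integrable fun x => Complex.exp (a x * Complex.I) * (v x : ℂ) := by
    intro v hv a
    refine hv.ofReal.bdd_mul (c := 1) (by fun_prop) (Eventually.of_forall fun x => ?_)
    rw [Complex.norm_exp_ofReal_mul_I]
  have hμν : μ = ν := by
    refine Measure.ext_of_charFunDual (funext fun a => ?_)
    rw [charFunDual_apply, charFunDual_apply,
      integral_withDensity_eq_integral_toReal_smul₀ hp.aemeasurable.ennreal_ofReal
        (Eventually.of_forall fun _ => ENNReal.ofReal_lt_top),
      integral_withDensity_eq_integral_toReal_smul₀ hn.aemeasurable.ennreal_ofReal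
        (Eventually.of_forall fun _ => ENNReal.ofReal_lt_top)]
    rw [← sub_eq_zero, ← h a, ← integral_sub]
    · refine integral_congr_ae (Eventually.of_forall fun x => ?_)
      have : (u x : ℂ) = ((u x)⁺ : ℝ) - ((u x)⁻ : ℝ) := by
        rw [← Complex.ofReal_sub, posPart_sub_negPart]
      simp only [this, ENNReal.toReal_ofReal (posPart_nonneg _),
        ENNReal.toReal_ofReal (negPart_nonneg _), Complex.real_smul]
      ring
    · refine (hb hp a).congr (Eventually.of_forall fun x => ?_)
      dsimp only
      rw [ENNReal.toReal_ofReal (posPart_nonneg _), Complex.real_smul, mul_comm]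
    · refine (hb hn a).congr (Eventually.of_forall fun x => ?_)
      dsimp only
      rw [ENNReal.toReal_ofReal (negPart_nonneg _), Complex.real_smul, mul_comm]
  rw [withDensity_eq_iff hp.aemeasurable.ennreal_ofReal hn.aemeasurable.ennreal_ofReal] at hμν
  · filter_upwards [hμν] with x hx
    rw [ENNReal.ofReal_eq_ofReal_iff (posPart_nonneg _) (negPart_nonneg _)] at hx
    rw [← posPart_sub_negPart (u x), hx, sub_self]
    rfl
  · exact (hp.lintegral_lt_top).ne

/-- Part of the Gaussian decay absorbs the exponential, and what remains is the ground state for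
field `b / 2`. Being square integrable, it gives an integrable product with any `L²` function. -/
theorem exp_mul_norm_ground_le {b : ℝ} (hb : 0 < b) (a : ℝ × ℝ →L[ℝ] ℝ) :
    ∃ C : ℝ, ∀ x, Real.exp |a x| * ‖ground hb x‖ ≤ C * ‖ground (half_pos hb) x‖ := by
  refine ⟨√(b / (2 * Real.pi)) / √(b / 2 / (2 * Real.pi)) * Real.exp (2 * ‖a‖ ^ 2 / b), fun x => ?_⟩
  have hs : √(b / 2 / (2 * Real.pi)) ≠ 0 := by positivity
  rw [norm_ground, norm_ground]
  have h1 : |a x| ≤ ‖a‖ * ‖x‖ := a.le_opNorm x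
  have h2 : ‖a‖ * ‖x‖ ≤ 2 * ‖a‖ ^ 2 / b + b / 8 * ‖x‖ ^ 2 := by
    have : 2 * ‖a‖ ^ 2 / b + b / 8 * ‖x‖ ^ 2 - ‖a‖ * ‖x‖ = (4 * ‖a‖ - b * ‖x‖) ^ 2 / (8 * b) := by
      field_simp; ring
    have : 0 ≤ (4 * ‖a‖ - b * ‖x‖) ^ 2 / (8 * b) := by positivity
    linarith
  have h3 : ‖x‖ ^ 2 ≤ x.1 ^ 2 + x.2 ^ 2 := by
    have := groundExp_re_ge (b := 4) (by norm_num) x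
    rw [groundExp_re] at this
    linarith
  calc Real.exp |a x| * (√(b / (2 * Real.pi)) * Real.exp (-(b / 4 * (x.1 ^ 2 + x.2 ^ 2))))
      = √(b / (2 * Real.pi)) * Real.exp (|a x| + -(b / 4 * (x.1 ^ 2 + x.2 ^ 2))) := by
        rw [Real.exp_add]; ring
    _ ≤ √(b / (2 * Real.pi)) *
        Real.exp (2 * ‖a‖ ^ 2 / b + -(b / 2 / 4 * (x.1 ^ 2 + x.2 ^ 2))) := by
        have := mul_le_mul_of_nonneg_left h3 (by positivity : 0 ≤ b / 8)
        refine mul_le_mul_of_nonneg_left (Real.exp_le_exp.2 ?_) (by positivity)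
        linarith
    _ = _ := by
        rw [Real.exp_add]
        field_simp

/-- The product of `f` with the conjugate Gaussian has all exponential moments. Its Fourier
transform is thus the sum of its power series, whose coefficients vanish by hypothesis, and the
Gaussian has no zeros. -/
theorem eq_zero_of_integral_pow_eq_zero {b : ℝ} (hb : 0 < b) (f : L2)
    (h : ∀ (a : ℝ × ℝ →L[ℝ] ℝ) (k : ℕ), ∫ x, starRingEnd ℂ (ground hb x) * f x * (a x : ℂ) ^ k = 0) :
    f = 0 := by
  set w : ℝ × ℝ → ℂ := fun x => starRingEnd ℂ (ground hb x) * f x with hw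
  have hexp : ∀ a : ℝ × ℝ →L[ℝ] ℝ, Integrable fun x => Real.exp |a x| * ‖w x‖ := by
    intro a
    obtain ⟨C, hC⟩ := exp_mul_norm_ground_le hb a
    have hg := (((ground (half_pos hb)).memLp 2 volume).norm.integrable_mul
      (Lp.memLp f).norm).const_mul C
    refine hg.mono' ?_ (Eventually.of_forall fun x => ?_)
    · refine AEStronglyMeasurable.mul (by fun_prop) (AEStronglyMeasurable.norm ?_)
      exact (Complex.continuous_conj.comp (ground hb).continuous).aestronglyMeasurable.mul
        (Lp.aestronglyMeasurable f)
    · rw [Real.norm_of_nonneg (by positivity), hw]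
      simp only [norm_mul, RCLike.norm_conj, Pi.mul_apply]
      calc Real.exp |a x| * (‖ground hb x‖ * ‖f x‖)
          = (Real.exp |a x| * ‖ground hb x‖) * ‖f x‖ := by ring
        _ ≤ (C * ‖ground (half_pos hb) x‖) * ‖f x‖ :=
            mul_le_mul_of_nonneg_right (hC x) (norm_nonneg _)
        _ = _ := by ring
  have hwm : AEStronglyMeasurable w volume :=
    (Complex.continuous_conj.comp (ground hb).continuous).aestronglyMeasurable.mul
        (Lp.aestronglyMeasurable f)
  have hwi : Integrable w := by
    have := hexp 0
    simp only [zero_apply, abs_zero, Real.exp_zero, one_mul] at this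
    exact (integrable_norm_iff hwm).1 this
  have key : ∀ (v : ℝ × ℝ → ℝ), AEStronglyMeasurable v volume → (∀ x, |v x| ≤ ‖w x‖) →
      (∀ (a : ℝ × ℝ →L[ℝ] ℝ) (k : ℕ), ∫ x, (v x : ℂ) * (a x : ℂ) ^ k = 0) → v =ᵐ[volume] 0 := by
    intro v hvm hvw hv
    refine ae_eq_zero_of_integral_cexp_eq_zero
      (hwi.norm.mono' hvm (Eventually.of_forall hvw)) fun a => ?_
    have hsum := hasSum_integral_of_dominated_convergence (μ := volume)
      (F := fun (k : ℕ) x => (Complex.I ^ k / k.factorial) * ((v x : ℂ) * (a x : ℂ) ^ k))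
      (f := fun x => Complex.exp (a x * Complex.I) * (v x : ℂ))
      (fun k x => (|a x| ^ k / k.factorial) * ‖w x‖) (fun k => ?_)
      (fun k => Eventually.of_forall fun x => ?_) (Eventually.of_forall fun x => ?_) ?_
      (Eventually.of_forall fun x => ?_)
    · refine hsum.unique ?_
      simp only [integral_const_mul, hv, mul_zero]
      exact hasSum_zero
    · refine AEStronglyMeasurable.const_mul (AEStronglyMeasurable.mul ?_ (by fun_prop)) _
      exact Complex.continuous_ofReal.comp_aestronglyMeasurable hvm
    · simp only [norm_mul, norm_div, norm_pow, Complex.norm_I, one_pow, Complex.norm_natCast,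
        Complex.norm_real, Real.norm_eq_abs]
      calc 1 / (k.factorial : ℝ) * (|v x| * |a x| ^ k)
          ≤ 1 / (k.factorial : ℝ) * (‖w x‖ * |a x| ^ k) := by gcongr; exact hvw x
        _ = _ := by ring
    · exact (Real.summable_pow_div_factorial _).mul_right _
    · refine (hexp a).congr (Eventually.of_forall fun x => ?_)
      dsimp only
      rw [tsum_mul_right, Real.exp_eq_exp_ℝ, NormedSpace.exp_eq_tsum_div]
    · have := (NormedSpace.expSeries_div_hasSum_exp (𝔸 := ℂ) (a x * Complex.I)).mul_right (v x : ℂ)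
      rw [← Complex.exp_eq_exp_ℂ] at this
      have e : (fun k : ℕ => Complex.I ^ k / k.factorial * ((v x : ℂ) * (a x : ℂ) ^ k)) =
          fun k : ℕ => ((a x : ℂ) * Complex.I) ^ k / k.factorial * (v x : ℂ) := by
        funext k
        ring
      exact e ▸ this
  have hint : ∀ (a : ℝ × ℝ →L[ℝ] ℝ) (k : ℕ), Integrable fun x => w x * (a x : ℂ) ^ k := by
    intro a k
    refine ((hexp a).const_mul (k.factorial : ℝ)).mono' (hwm.mul (by fun_prop))
      (Eventually.of_forall fun x => ?_)
    have := Real.pow_div_factorial_le_exp |a x| (abs_nonneg _) k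
    rw [div_le_iff₀ (by positivity)] at this
    rw [norm_mul, norm_pow, Complex.norm_real, Real.norm_eq_abs]
    calc ‖w x‖ * |a x| ^ k ≤ ‖w x‖ * (Real.exp |a x| * k.factorial) := by gcongr
      _ = _ := by ring
  -- Uniqueness of the Fourier transform was obtained for real densities, so real and imaginary
  -- parts are treated separately.
  have hre : (fun x => (w x).re) =ᵐ[volume] 0 := by
    refine key _ hwm.re (fun x => Complex.abs_re_le_norm _) fun a k => ?_
    have := Complex.reCLM.integral_comp_comm (hint a k)
    rw [h a k, map_zero] at this
    rw [← Complex.ofReal_zero, ← this, ← integral_complex_ofReal]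
    refine integral_congr_ae (Eventually.of_forall fun x => ?_)
    simp [← Complex.ofReal_pow]
  have him : (fun x => (w x).im) =ᵐ[volume] 0 := by
    refine key _ hwm.im (fun x => Complex.abs_im_le_norm _) fun a k => ?_
    have := Complex.imCLM.integral_comp_comm (hint a k)
    rw [h a k, map_zero] at this
    rw [← Complex.ofReal_zero, ← this, ← integral_complex_ofReal]
    refine integral_congr_ae (Eventually.of_forall fun x => ?_)
    simp [← Complex.ofReal_pow]
  rw [Lp.eq_zero_iff_ae_eq_zero]
  filter_upwards [hre, him] with x h1 h2
  have h3 : w x = 0 := Complex.ext h1 h2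
  have h4 : ground hb x ≠ 0 := by
    rw [← norm_pos_iff, norm_ground]
    positivity
  simpa [hw, h4] using h3

theorem span_psi_invariant {b : ℝ} (hb : 0 < b) (T : Module.End ℂ Sch)
    (hT : ∀ n m, T (psi hb n m) ∈ Submodule.span ℂ (Set.range fun p : ℕ × ℕ => psi hb p.1 p.2))
    {φ : Sch} (hφ : φ ∈ Submodule.span ℂ (Set.range fun p : ℕ × ℕ => psi hb p.1 p.2)) :
    T φ ∈ Submodule.span ℂ (Set.range fun p : ℕ × ℕ => psi hb p.1 p.2) := by
  have : Submodule.map T (Submodule.span ℂ (Set.range fun p : ℕ × ℕ => psi hb p.1 p.2)) ≤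
      Submodule.span ℂ (Set.range fun p : ℕ × ℕ => psi hb p.1 p.2) := by
    rw [Submodule.map_span_le]
    rintro _ ⟨p, rfl⟩
    exact hT _ _
  exact this (Submodule.mem_map_of_mem hφ)

theorem mulLin_mem_span_psi {b : ℝ} (hb : 0 < b) (a : ℝ × ℝ →L[ℝ] ℝ)
    {φ : Sch} (hφ : φ ∈ Submodule.span ℂ (Set.range fun p : ℕ × ℕ => psi hb p.1 p.2)) :
    mulLin a φ ∈ Submodule.span ℂ (Set.range fun p : ℕ × ℕ => psi hb p.1 p.2) := by
  set V := Submodule.span ℂ (Set.range fun p : ℕ × ℕ => psi hb p.1 p.2)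
  have hpsi : ∀ n m, psi hb n m ∈ V := fun n m => Submodule.subset_span ⟨(n, m), rfl⟩
  have h1 : raise b φ ∈ V := span_psi_invariant hb _ (fun n m => by
    rw [raise_psi]; exact V.smul_mem _ (hpsi _ _)) hφ
  have h2 : raiseDeg b φ ∈ V := span_psi_invariant hb _ (fun n m => by
    rw [raiseDeg_psi]; exact V.smul_mem _ (hpsi _ _)) hφ
  have h3 : lower b φ ∈ V := span_psi_invariant hb _ (fun n m => by
    cases n with
    | zero => rw [lower_psi_zero]; exact V.zero_mem
    | succ n => rw [lower_psi_succ]; exact V.smul_mem _ (hpsi _ _)) hφ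
  have h4 : lowerDeg b φ ∈ V := span_psi_invariant hb _ (fun n m => by
    cases m with
    | zero => rw [lowerDeg_psi_zero]; exact V.zero_mem
    | succ m => rw [lowerDeg_psi_succ]; exact V.smul_mem _ (hpsi _ _)) hφ
  have e : mulLin a φ = (a (1, 0) : ℂ) • mulLin (ContinuousLinearMap.fst ℝ ℝ ℝ) φ +
      (a (0, 1) : ℂ) • mulLin (ContinuousLinearMap.snd ℝ ℝ ℝ) φ := by
    ext x
    have : a x = a (1, 0) * x.1 + a (0, 1) * x.2 := by
      conv_lhs => rw [show x = x.1 • ((1, 0) : ℝ × ℝ) + x.2 • ((0, 1) : ℝ × ℝ) by ext <;> simp]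
      rw [map_add, map_smul, map_smul, smul_eq_mul, smul_eq_mul]
      ring
    simp [mulLin_apply, this]
    ring
  rw [e, mulLin_fst_eq hb, mulLin_snd_eq hb, kin1_eq hb, kin2_eq hb, pse1_eq hb, pse2_eq hb]
  exact V.add_mem
    (V.smul_mem _ (V.smul_mem _ (V.sub_mem (V.smul_mem _ (V.sub_mem h1 h3))
      (V.smul_mem _ (V.sub_mem h4 h2)))))
    (V.smul_mem _ (V.smul_mem _ (V.sub_mem (V.smul_mem _ (V.add_mem h4 h2))
      (V.smul_mem _ (V.add_mem h3 h1)))))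

theorem eq_zero_of_inner_psi_eq_zero {b : ℝ} (hb : 0 < b) (f : L2)
    (h : ∀ n m, inner ℂ (psi hb n m).toL2 f = 0) : f = 0 := by
  have hV : ∀ φ ∈ Submodule.span ℂ (Set.range fun p : ℕ × ℕ => psi hb p.1 p.2),
      inner ℂ φ.toL2 f = 0 := by
    intro φ hφ
    induction hφ using Submodule.span_induction with
    | mem x hx => obtain ⟨p, rfl⟩ := hx; exact h _ _
    | zero => rw [Sch.toL2_zero, inner_zero_left]
    | add x y _ _ hx hy => rw [Sch.toL2_add, inner_add_left, hx, hy, add_zero]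
    | smul c x _ hx => rw [Sch.toL2_smul, inner_smul_left, hx, mul_zero]
  refine eq_zero_of_integral_pow_eq_zero hb f fun a k => ?_
  have hap : ∀ x, (mulLin a ^ k) (ground hb) x = (a x : ℂ) ^ k * ground hb x := by
    intro x
    induction k with
    | zero => simp
    | succ k ih =>
      rw [pow_succ', Module.End.mul_apply, mulLin_apply, ih]
      ring
  have hmem : (mulLin a ^ k) (ground hb) ∈
      Submodule.span ℂ (Set.range fun p : ℕ × ℕ => psi hb p.1 p.2) := by
    clear hap
    induction k with
    | zero => exact Submodule.subset_span ⟨(0, 0), psi_zero_zero hb⟩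
    | succ k ih =>
      rw [pow_succ', Module.End.mul_apply]
      exact mulLin_mem_span_psi hb a ih
  rw [← hV _ hmem, L2.inner_def]
  refine integral_congr_ae ?_
  filter_upwards [((mulLin a ^ k) (ground hb)).coeFn_toLp 2 volume] with x hx
  rw [hx, hap, RCLike.inner_apply, map_mul, map_pow, Complex.conj_ofReal]
  ring

/-- The Hilbert basis of joint eigenfunctions. -/
def psiBasis {b : ℝ} (hb : 0 < b) : HilbertBasis (ℕ × ℕ) ℂ L2 :=
  HilbertBasis.mkOfOrthogonalEqBot (orthonormal_psi hb) (by
    rw [Submodule.eq_bot_iff]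
    intro f hf
    refine eq_zero_of_inner_psi_eq_zero hb f fun n m => ?_
    exact hf _ (Submodule.subset_span ⟨(n, m), rfl⟩))

theorem psiBasis_apply {b : ℝ} (hb : 0 < b) (p : ℕ × ℕ) :
    psiBasis hb p = (psi hb p.1 p.2).toL2 := by
  rw [psiBasis, HilbertBasis.coe_mkOfOrthogonalEqBot]

theorem clm_ext_hilbertBasis {ι E F : Type*} [NormedAddCommGroup E] [InnerProductSpace ℂ E]
    [NormedAddCommGroup F] [NormedSpace ℂ F] (e : HilbertBasis ι ℂ E) {S T : E →L[ℂ] F}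
    (h : ∀ i, S (e i) = T (e i)) : S = T := by
  refine ContinuousLinearMap.ext_on (s := Set.range e) ?_ ?_
  · rw [dense_iff_closure_eq, ← Submodule.topologicalClosure_coe, e.dense_span]
    rfl
  · rintro _ ⟨i, rfl⟩
    exact h i

/-! ### Landau levels -/

/-- Square summable sequences. -/
abbrev Seq : Type := lp (fun _ : ℕ => ℂ) 2

/-- The standard basis of the space of square summable sequences. -/
def seqBasis : HilbertBasis ℕ ℂ Seq := HilbertBasis.ofRepr (LinearIsometryEquiv.refl ℂ _)

theorem inner_seqBasis (m : ℕ) (g : Seq) : inner ℂ (seqBasis m) g = g m := by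
  rw [← HilbertBasis.repr_apply_apply]
  rfl

theorem enorm_seq_sq (g : Seq) : ‖g‖ₑ ^ 2 = ∑' m, ‖g m‖ₑ ^ 2 := by
  rw [enorm_sq_eq_tsum_enorm_inner seqBasis]
  simp only [inner_seqBasis]

theorem orthonormal_level {b : ℝ} (hb : 0 < b) (n : ℕ) :
    Orthonormal ℂ (fun m => (psi hb n m).toL2) :=
  (orthonormal_psi hb).comp (fun m => (n, m)) fun _ _ h => (Prod.ext_iff.1 h).2

/-- The isometric parametrisation of a Landau level by sequences. -/
def levelMap {b : ℝ} (hb : 0 < b) (n : ℕ) : Seq →L[ℂ] L2 :=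
  (orthonormal_level hb n).orthogonalFamily.linearIsometry.toContinuousLinearMap

theorem enorm_levelMap {b : ℝ} (hb : 0 < b) (n : ℕ) (g : Seq) : ‖levelMap hb n g‖ₑ = ‖g‖ₑ :=
  (orthonormal_level hb n).orthogonalFamily.linearIsometry.enorm_map g

theorem levelMap_seqBasis {b : ℝ} (hb : 0 < b) (n m : ℕ) :
    levelMap hb n (seqBasis m) = (psi hb n m).toL2 := by
  have : seqBasis m = lp.single 2 m 1 := by
    rw [← HilbertBasis.repr_symm_single]
    rfl
  rw [this]
  exact ((orthonormal_level hb n).orthogonalFamily.linearIsometry_apply_single _).trans (by simp)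

/-- The coefficients in a Landau level. -/
def levelCoeff {b : ℝ} (hb : 0 < b) (n : ℕ) : L2 →L[ℂ] Seq :=
  ContinuousLinearMap.adjoint (levelMap hb n)

theorem levelCoeff_apply {b : ℝ} (hb : 0 < b) (n m : ℕ) (f : L2) :
    levelCoeff hb n f m = inner ℂ (psi hb n m).toL2 f := by
  rw [← inner_seqBasis, levelCoeff, ContinuousLinearMap.adjoint_inner_right, levelMap_seqBasis]

theorem levelCoeff_psi {b : ℝ} (hb : 0 < b) (n n' m : ℕ) :
    levelCoeff hb n (psi hb n' m).toL2 = if n = n' then seqBasis m else 0 := by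
  ext k
  rw [levelCoeff_apply, inner_psi_psi]
  split_ifs with h1 h2 h2
  · rw [← inner_seqBasis, h1.2, orthonormal_iff_ite.1 seqBasis.orthonormal]; simp
  · exact absurd h1.1 h2
  · rw [← inner_seqBasis, orthonormal_iff_ite.1 seqBasis.orthonormal, if_neg fun h => h1 ⟨h2, h⟩]
  · rfl

theorem levelCoeff_levelMap {b : ℝ} (hb : 0 < b) (n n' : ℕ) (g : Seq) :
    levelCoeff hb n (levelMap hb n' g) = if n = n' then g else 0 := by
  have : levelCoeff hb n ∘L levelMap hb n' =
      if n = n' then ContinuousLinearMap.id ℂ Seq else 0 := by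
    refine clm_ext_hilbertBasis seqBasis fun m => ?_
    rw [ContinuousLinearMap.comp_apply, levelMap_seqBasis, levelCoeff_psi]
    split_ifs <;> rfl
  rw [← ContinuousLinearMap.comp_apply, this]
  split_ifs <;> rfl

theorem enorm_sq_eq_tsum_levelCoeff {b : ℝ} (hb : 0 < b) (f : L2) :
    ‖f‖ₑ ^ 2 = ∑' n, ‖levelCoeff hb n f‖ₑ ^ 2 := by
  rw [enorm_sq_eq_tsum_enorm_inner (psiBasis hb), ENNReal.tsum_prod']
  simp only [enorm_seq_sq, levelCoeff_apply, psiBasis_apply]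

/-- The action of the magnetic translations inside a Landau level. -/
def magSeq {b : ℝ} (hb : 0 < b) (R : ℝ × ℝ) : Seq →L[ℂ] Seq :=
  levelCoeff hb 0 ∘L magTranslation b R ∘L levelMap hb 0

/-- The matrix elements of a translation vanish between different levels and do not depend on the
level, so one operator on sequences describes its action on all of them. -/
theorem magTranslation_levelMap {b : ℝ} (hb : 0 < b) (R : ℝ × ℝ) (n : ℕ) (g : Seq) :
    magTranslation b R (levelMap hb n g) = levelMap hb n (magSeq hb R g) := by
  have : magTranslation b R ∘L levelMap hb n = levelMap hb n ∘L magSeq hb R := by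
    refine clm_ext_hilbertBasis seqBasis fun m => ?_
    refine (psiBasis hb).repr.injective (lp.ext (funext fun p => ?_))
    rw [HilbertBasis.repr_apply_apply, HilbertBasis.repr_apply_apply, psiBasis_apply,
      ContinuousLinearMap.comp_apply, levelMap_seqBasis, inner_psi_magTranslation,
      ContinuousLinearMap.comp_apply, ← levelCoeff_apply hb p.1 p.2 (levelMap hb n _), levelCoeff_levelMap]
    split_ifs
    · rw [magSeq, ContinuousLinearMap.comp_apply, levelCoeff_apply, ContinuousLinearMap.comp_apply,
        levelMap_seqBasis]
    · rfl
  exact congrArg (fun T : Seq →L[ℂ] L2 => T g) this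

theorem levelCoeff_magTranslation {b : ℝ} (hb : 0 < b) (R : ℝ × ℝ) (n : ℕ) (f : L2) :
    levelCoeff hb n (magTranslation b R f) = magSeq hb R (levelCoeff hb n f) := by
  have : levelCoeff hb n ∘L magTranslation b R = magSeq hb R ∘L levelCoeff hb n := by
    refine clm_ext_hilbertBasis (psiBasis hb) fun p => ?_
    rw [ContinuousLinearMap.comp_apply, ContinuousLinearMap.comp_apply, psiBasis_apply,
      levelCoeff_psi, ← levelMap_seqBasis, magTranslation_levelMap, levelCoeff_levelMap]
    split_ifs <;> simp
  exact congrArg (fun T : L2 →L[ℂ] Seq => T f) this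

/-- The operator mapping the level `k` onto the level `j`. -/
def levelUnit {b : ℝ} (hb : 0 < b) (j k : ℕ) : L2 →L[ℂ] L2 := levelMap hb j ∘L levelCoeff hb k

theorem levelUnit_apply {b : ℝ} (hb : 0 < b) (j k : ℕ) (f : L2) :
    levelUnit hb j k f = levelMap hb j (levelCoeff hb k f) := rfl

theorem enorm_levelUnit {b : ℝ} (hb : 0 < b) (j k : ℕ) (f : L2) :
    ‖levelUnit hb j k f‖ₑ = ‖levelCoeff hb k f‖ₑ :=
  enorm_levelMap hb j _

theorem adjoint_levelUnit {b : ℝ} (hb : 0 < b) (j k : ℕ) :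
    ContinuousLinearMap.adjoint (levelUnit hb j k) = levelUnit hb k j := by
  rw [levelUnit, levelUnit, ContinuousLinearMap.adjoint_comp, levelCoeff, levelCoeff,
    ContinuousLinearMap.adjoint_adjoint]

theorem commute_levelUnit {b : ℝ} (hb : 0 < b) (j k : ℕ) (R : ℝ × ℝ) :
    Commute (levelUnit hb j k) (magTranslation b R) := by
  refine ContinuousLinearMap.ext fun f => ?_
  change levelMap hb j (levelCoeff hb k (magTranslation b R f)) =
    magTranslation b R (levelMap hb j (levelCoeff hb k f))
  rw [levelCoeff_magTranslation, magTranslation_levelMap]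

/-! ### The density of a Landau level -/

/-- Parseval in the fixed basis, after exchanging the sums, gives the sum over `m` of `‖1_Q ψₙₘ‖²`.
-/
theorem hsNormSq_levelCoeff_cutoff {b : ℝ} (hb : 0 < b) (n : ℕ) {Q : Set (ℝ × ℝ)}
    (hQ : MeasurableSet Q) :
    hsNormSq (levelCoeff hb n ∘L cutoff Q hQ) = ∫⁻ x in Q, ∑' m, ‖psi hb n m x‖ₑ ^ 2 := by
  rw [lintegral_tsum fun m => ((psi hb n m).continuous.measurable.enorm.pow_const 2).aemeasurable]
  have h : ∀ m, ∫⁻ x in Q, ‖psi hb n m x‖ₑ ^ 2 = ‖cutoff Q hQ (psi hb n m).toL2‖ₑ ^ 2 := by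
    intro m
    rw [enorm_cutoff_sq]
    refine lintegral_congr_ae (ae_restrict_of_ae ?_)
    filter_upwards [(psi hb n m).coeFn_toLp 2 volume] with x hx
    rw [hx]
  simp_rw [h, hsNormSq, ContinuousLinearMap.comp_apply, enorm_seq_sq, levelCoeff_apply]
  rw [ENNReal.tsum_comm]
  refine tsum_congr fun m => ?_
  rw [enorm_sq_eq_tsum_enorm_inner basis]
  refine tsum_congr fun i => ?_
  rw [← isSelfAdjoint_cutoff hQ, ContinuousLinearMap.adjoint_inner_right, ← inner_conj_symm,
    RCLike.enorm_conj, isSelfAdjoint_cutoff]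

/-- With `s = b |x|² / 2`, the terms are `b / 2π` times the Poisson weights `e^{-s} s^m / m!`, which
sum to one. -/
theorem tsum_enorm_psi_zero {b : ℝ} (hb : 0 < b) (x : ℝ × ℝ) :
    ∑' m, ‖psi hb 0 m x‖ₑ ^ 2 = ENNReal.ofReal (b / (2 * Real.pi)) := by
  set s := b / 2 * (x.1 ^ 2 + x.2 ^ 2) with hs
  have h : ∀ m, ‖psi hb 0 m x‖ ^ 2 =
      s ^ m / m.factorial * (b / (2 * Real.pi) * Real.exp (-s)) := by
    intro m
    have h1 : psi hb 0 m x = (((√(m.factorial))⁻¹ : ℝ) : ℂ) * ((ladderNorm b * Complex.I * b) ^ m *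
        (((x.1 : ℂ) - Complex.I * x.2) ^ m * ground hb x)) := by
      rw [psi, pow_zero, Module.End.one_apply, raiseDeg_pow_ground]
      simp [mulConj_pow_apply]
    have h2 : ‖(x.1 : ℂ) - Complex.I * x.2‖ ^ 2 = x.1 ^ 2 + x.2 ^ 2 := by
      rw [← Complex.normSq_eq_norm_sq, Complex.normSq_apply]
      simp
      ring
    have h3 : ‖ladderNorm b * Complex.I * b‖ ^ 2 = b / 2 := by
      rw [norm_mul, norm_mul, Complex.norm_I, ladderNorm, Complex.norm_real, Complex.norm_real,
        mul_one, mul_pow, Real.norm_eq_abs, Real.norm_eq_abs, sq_abs, sq_abs, inv_pow,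
        Real.sq_sqrt (by positivity)]
      field_simp
    have h4 : ‖ground hb x‖ ^ 2 = b / (2 * Real.pi) * Real.exp (-s) := by
      rw [norm_ground, mul_pow, Real.sq_sqrt (by positivity), ← Real.exp_nat_mul, hs]
      congr 2
      push_cast
      ring
    have h5 : ‖(((√(m.factorial))⁻¹ : ℝ) : ℂ)‖ ^ 2 = (m.factorial : ℝ)⁻¹ := by
      rw [Complex.norm_real, Real.norm_eq_abs, sq_abs, inv_pow, Real.sq_sqrt (by positivity)]
    rw [h1, norm_mul, norm_mul, norm_mul, norm_pow, norm_pow, mul_pow, mul_pow, mul_pow, h4, h5,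
      ← pow_mul, ← pow_mul, mul_comm m, pow_mul, pow_mul, h2, h3, hs, mul_pow]
    ring
  have hsum : HasSum (fun m : ℕ => s ^ m / m.factorial * (b / (2 * Real.pi) * Real.exp (-s)))
      (b / (2 * Real.pi)) := by
    have := (NormedSpace.expSeries_div_hasSum_exp (𝔸 := ℝ) s).mul_right
      (b / (2 * Real.pi) * Real.exp (-s))
    rw [← Real.exp_eq_exp_ℝ, mul_left_comm, ← Real.exp_add, add_neg_cancel, Real.exp_zero,
      mul_one] at this
    exact this
  simp_rw [← ofReal_norm, ← ENNReal.ofReal_pow (norm_nonneg _), h]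
  rw [← ENNReal.ofReal_tsum_of_nonneg _ hsum.summable, hsum.tsum_eq]
  intro m
  have : 0 ≤ s := by positivity
  positivity

/-- The measure with density `∑ₘ |ψₙₘ|²`. -/
def levelMeasure {b : ℝ} (hb : 0 < b) (n : ℕ) : Measure (ℝ × ℝ) :=
  volume.withDensity fun x => ∑' m, ‖psi hb n m x‖ₑ ^ 2

theorem levelMeasure_apply {b : ℝ} (hb : 0 < b) (n : ℕ) {Q : Set (ℝ × ℝ)}
    (hQ : MeasurableSet Q) :
    levelMeasure hb n Q = hsNormSq (levelCoeff hb n ∘L cutoff Q hQ) := by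
  rw [hsNormSq_levelCoeff_cutoff, levelMeasure, withDensity_apply _ hQ]

theorem levelMeasure_zero_apply {b : ℝ} (hb : 0 < b) {Q : Set (ℝ × ℝ)} (hQ : MeasurableSet Q) :
    levelMeasure hb 0 Q = ENNReal.ofReal (b / (2 * Real.pi)) * volume Q := by
  simp only [levelMeasure, tsum_enorm_psi_zero]
  rw [withDensity_apply _ hQ, setLIntegral_const]

/-- The trace property for the operator carrying level 0 onto level `n`: composed with its adjoint,
it yields the projection on level 0 in one order and on level `n` in the other. -/
theorem levelMeasure_cell {b L : ℝ} (hb : 0 < b) (hL : 0 < L) (n : ℕ) :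
    levelMeasure hb n (cell L 0) = ENNReal.ofReal (b / (2 * Real.pi)) * volume (cell L 0) := by
  have hQ := measurableSet_cell L 0
  rw [← levelMeasure_zero_apply hb hQ, levelMeasure_apply hb _ hQ, levelMeasure_apply hb _ hQ]
  have h := hsNormSq_cell_adjoint hL (T := levelUnit hb n 0) (commute_levelUnit hb n 0)
  rw [adjoint_levelUnit] at h
  rw [hsNormSq_congr (T := levelUnit hb 0 n * cutoff (cell L 0) hQ)
    fun f => (enorm_levelUnit hb 0 n _).symm, h]
  exact hsNormSq_congr fun f => enorm_levelUnit hb n 0 _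

instance {b : ℝ} (hb : 0 < b) (n : ℕ) : (levelMeasure hb n).IsAddLeftInvariant where
  map_add_left_eq_self R := by
    ext Q hQ
    have hm : Measurable fun x : ℝ × ℝ => R + x := measurable_const_add R
    rw [Measure.map_apply hm hQ, levelMeasure_apply hb n hQ, levelMeasure_apply hb n (hm hQ),
      hsNormSq_congr (S := levelCoeff hb n ∘L cutoff Q hQ) (T := levelUnit hb n n * cutoff Q hQ)
        fun f => (enorm_levelUnit hb n n _).symm,
      hsNormSq_cutoff_translate hQ (hm hQ) b R (fun x => by simp) (commute_levelUnit hb n n R)]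
    exact hsNormSq_congr fun f => (enorm_levelUnit hb n n _).symm

theorem volume_cell {L : ℝ} (hL : 0 < L) : volume (cell L 0) = ENNReal.ofReal (L ^ 2) := by
  rw [cell, Measure.volume_eq_prod, Measure.prod_prod, Real.volume_Ico, Real.volume_Ico,
    ← ENNReal.ofReal_mul (by simp [hL.le])]
  congr 1
  simp
  ring

theorem exists_subset_cell {K : Set (ℝ × ℝ)} (hK : Bornology.IsBounded K) :
    ∃ L, 0 < L ∧ K ⊆ cell L 0 := by
  obtain ⟨r, hr⟩ := hK.subset_ball 0
  refine ⟨2 * (|r| + 1), by positivity, fun x hx => ?_⟩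
  have h := hr hx
  rw [mem_ball_zero_iff, Prod.norm_def, max_lt_iff, Real.norm_eq_abs, Real.norm_eq_abs, abs_lt,
    abs_lt] at h
  have := le_abs_self r
  obtain ⟨⟨h1, h2⟩, h3, h4⟩ := h
  simp only [cell, Set.mem_prod, Set.mem_Ico, Prod.fst_zero, Prod.snd_zero, zsmul_eq_mul,
    Int.cast_zero, zero_mul, zero_add, Int.cast_one, one_mul, add_zero]
  refine ⟨⟨?_, ?_⟩, ?_, ?_⟩ <;> linarith

instance {b : ℝ} (hb : 0 < b) (n : ℕ) : IsFiniteMeasureOnCompacts (levelMeasure hb n) where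
  lt_top_of_isCompact K hK := by
    obtain ⟨L, hL, hKL⟩ := exists_subset_cell hK.isBounded
    refine (measure_mono hKL).trans_lt ?_
    rw [levelMeasure_cell hb hL, volume_cell hL]
    exact ENNReal.mul_lt_top ENNReal.ofReal_lt_top ENNReal.ofReal_lt_top

/-- Every Landau level has the constant density `b / 2π`. -/
theorem hsNormSq_levelCoeff_cutoff_eq {b : ℝ} (hb : 0 < b) (n : ℕ) {Q : Set (ℝ × ℝ)}
    (hQ : MeasurableSet Q) : hsNormSq (levelCoeff hb n ∘L cutoff Q hQ) =
      ENNReal.ofReal (b / (2 * Real.pi)) * volume Q := by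
  have h := Measure.isAddLeftInvariant_eq_smul (levelMeasure hb n) (volume : Measure (ℝ × ℝ))
  set c := Measure.addHaarScalarFactor (levelMeasure hb n) (volume : Measure (ℝ × ℝ))
  -- The Haar factor is read off on the unit cell, where the density is already known.
  have h1 : levelMeasure hb n (cell 1 0) = c * volume (cell 1 0) := by rw [h]; rfl
  rw [levelMeasure_cell hb one_pos, volume_cell one_pos] at h1
  simp only [one_pow, ENNReal.ofReal_one, mul_one] at h1
  rw [← levelMeasure_apply hb n hQ, h, h1]
  rfl

/-! ### The quadratic form of the Landau operator -/

/-- The definition pairs bilinearly with test functions. Replacing the test function by its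
conjugate turns this into inner products with the formally symmetric momentum. -/
theorem isMagneticMomentum_iff (e : ℝ × ℝ) (a : ℝ × ℝ →L[ℝ] ℝ) (u v : L2) :
    IsMagneticMomentum e a u v ↔
      ∀ φ : Sch, inner ℂ φ.toL2 v = inner ℂ (momentum e a φ).toL2 u := by
  have h1 : ∀ φ : Sch, inner ℂ φ.toL2 v = ∫ x, v x * conjSch φ x := by
    intro φ
    rw [L2.inner_def]
    refine integral_congr_ae ?_
    filter_upwards [φ.coeFn_toLp 2 volume] with x hx
    rw [hx, RCLike.inner_apply]
    rfl
  have h2 : ∀ φ : Sch, inner ℂ (momentum e a φ).toL2 u =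
      ∫ x, u x * (Complex.I * fderiv ℝ (conjSch φ) x e + (a x : ℂ) * conjSch φ x) := by
    intro φ
    rw [L2.inner_def]
    refine integral_congr_ae ?_
    filter_upwards [(momentum e a φ).coeFn_toLp 2 volume] with x hx
    rw [hx, RCLike.inner_apply, momentum_apply, fderiv_conjSch, conjSch_apply]
    simp
  constructor
  · intro h φ
    rw [h1, h2]
    exact h (conjSch φ)
  · intro h φ
    have e1 : conjSch (conjSch φ) = φ := by
      ext x
      simp [conjSch_apply]
    have := h (conjSch φ)
    rwa [h1, h2, e1] at this

theorem isMagneticMomentum_kin1_iff (u v : L2) :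
    IsMagneticMomentum (1, 0) (fun _ => 0) u v ↔
      ∀ φ : Sch, inner ℂ φ.toL2 v = inner ℂ (kin1 φ).toL2 u :=
  isMagneticMomentum_iff (1, 0) 0 u v

theorem isMagneticMomentum_kin2_iff (b : ℝ) (u v : L2) :
    IsMagneticMomentum (0, 1) (fun x => b * x.1) u v ↔
      ∀ φ : Sch, inner ℂ φ.toL2 v = inner ℂ (kin2 b φ).toL2 u :=
  isMagneticMomentum_iff (0, 1) (b • ContinuousLinearMap.fst ℝ ℝ ℝ) u v

/-- Used with `s = √(b/2)`, for which `2 s² = b`: the two kinetic momenta are, up to phase, `s`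
times the sum and the difference of the ladder operators. -/
theorem enorm_parallelogram (s : ℝ) (α β : ℂ) :
    ‖(s : ℂ) * (α + β)‖ₑ ^ 2 + ‖Complex.I * s * (β - α)‖ₑ ^ 2 =
      ENNReal.ofReal (2 * s ^ 2) * (‖α‖ₑ ^ 2 + ‖β‖ₑ ^ 2) := by
  simp_rw [← ofReal_norm, ← ENNReal.ofReal_pow (norm_nonneg _)]
  rw [← ENNReal.ofReal_add (by positivity) (by positivity),
    ← ENNReal.ofReal_add (by positivity) (by positivity), ← ENNReal.ofReal_mul (by positivity)]
  congr 1
  have h := parallelogram_law_with_norm ℝ α β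
  rw [norm_mul, norm_mul, norm_mul, Complex.norm_I, Complex.norm_real, Real.norm_eq_abs, one_mul,
    mul_pow, mul_pow, sq_abs, norm_sub_rev β α]
  linear_combination s ^ 2 * h

theorem tsum_shift (f : ℕ → ℝ≥0∞) (h : f 0 = 0) : ∑' n, f (n + 1) = ∑' n, f n := by
  rw [tsum_eq_zero_add' (f := f) ENNReal.summable, h, zero_add]

theorem tsum_enorm_inner_lower {b : ℝ} (hb : 0 < b) (u : L2) :
    ∑' n, ∑' m, ‖inner ℂ (lower b (psi hb n m)).toL2 u‖ₑ ^ 2 =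
      ∑' n : ℕ, ((n + 1 : ℕ) : ℝ≥0∞) * ‖levelCoeff hb n u‖ₑ ^ 2 := by
  rw [← tsum_shift _ (by simp [lower_psi_zero, Sch.toL2_zero])]
  refine tsum_congr fun n => ?_
  rw [enorm_seq_sq, ← ENNReal.tsum_mul_left]
  refine tsum_congr fun m => ?_
  rw [lower_psi_succ, Sch.toL2_smul, inner_smul_left, Complex.conj_ofReal, levelCoeff_apply,
    enorm_mul, mul_pow]
  congr 1
  rw [← ofReal_norm, ← ENNReal.ofReal_pow (norm_nonneg _), Complex.norm_real, Real.norm_eq_abs,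
    sq_abs, Real.sq_sqrt (by positivity), ENNReal.ofReal_natCast]

theorem tsum_enorm_inner_raise {b : ℝ} (hb : 0 < b) (u : L2) :
    ∑' n, ∑' m, ‖inner ℂ (raise b (psi hb n m)).toL2 u‖ₑ ^ 2 =
      ∑' n : ℕ, (n : ℝ≥0∞) * ‖levelCoeff hb n u‖ₑ ^ 2 := by
  rw [← tsum_shift (fun n : ℕ => (n : ℝ≥0∞) * ‖levelCoeff hb n u‖ₑ ^ 2) (by simp)]
  refine tsum_congr fun n => ?_
  rw [enorm_seq_sq, ← ENNReal.tsum_mul_left]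
  refine tsum_congr fun m => ?_
  rw [raise_psi, Sch.toL2_smul, inner_smul_left, Complex.conj_ofReal, levelCoeff_apply,
    enorm_mul, mul_pow]
  congr 1
  rw [← ofReal_norm, ← ENNReal.ofReal_pow (norm_nonneg _), Complex.norm_real, Real.norm_eq_abs,
    sq_abs, Real.sq_sqrt (by positivity), ENNReal.ofReal_natCast]

/-- The spectral decomposition of the quadratic form of the Landau operator. -/
theorem enorm_momenta_eq {b : ℝ} (hb : 0 < b) {u v₁ v₂ : L2}
    (h₁ : IsMagneticMomentum (1, 0) (fun _ => 0) u v₁)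
    (h₂ : IsMagneticMomentum (0, 1) (fun x => b * x.1) u v₂) :
    ‖v₁‖ₑ ^ 2 + ‖v₂‖ₑ ^ 2 =
      ∑' n : ℕ, ENNReal.ofReal (b * (2 * n + 1)) * ‖levelCoeff hb n u‖ₑ ^ 2 := by
  rw [isMagneticMomentum_kin1_iff] at h₁
  rw [isMagneticMomentum_kin2_iff] at h₂
  have hp : ∀ p : ℕ × ℕ, ‖inner ℂ (psiBasis hb p) v₁‖ₑ ^ 2 + ‖inner ℂ (psiBasis hb p) v₂‖ₑ ^ 2 =
      ENNReal.ofReal b * (‖inner ℂ (lower b (psi hb p.1 p.2)).toL2 u‖ₑ ^ 2 +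
        ‖inner ℂ (raise b (psi hb p.1 p.2)).toL2 u‖ₑ ^ 2) := by
    intro p
    rw [psiBasis_apply, h₁, h₂, kin1_eq hb, kin2_eq hb, Sch.toL2_smul, Sch.toL2_smul,
      Sch.toL2_add, Sch.toL2_sub, inner_smul_left, inner_smul_left, inner_add_left,
      inner_sub_left, map_mul, map_neg, Complex.conj_I, Complex.conj_ofReal, neg_neg,
      enorm_parallelogram, Real.sq_sqrt (by positivity)]
    congr 2
    ring
  rw [enorm_sq_eq_tsum_enorm_inner (psiBasis hb) v₁, enorm_sq_eq_tsum_enorm_inner (psiBasis hb) v₂,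
    ← ENNReal.tsum_add]
  simp_rw [hp]
  rw [ENNReal.tsum_mul_left, ENNReal.tsum_add, ENNReal.tsum_prod', ENNReal.tsum_prod',
    tsum_enorm_inner_lower, tsum_enorm_inner_raise, ← ENNReal.tsum_add, ← ENNReal.tsum_mul_left]
  refine tsum_congr fun n => ?_
  rw [← add_mul, ← mul_assoc, ENNReal.ofReal_mul hb.le]
  congr 2
  rw [← Nat.cast_add, ← ENNReal.ofReal_natCast]
  congr 1
  push_cast
  ring

/-- Holds for every `u`, since off the form domain the infimum is over an empty family. The lower
bound needs only this; equality is needed only for finite sums of levels. -/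
theorem tsum_levelCoeff_le_landauForm {b : ℝ} (hb : 0 < b) (u : L2) :
    ∑' n : ℕ, ENNReal.ofReal (b * (2 * n + 1)) * ‖levelCoeff hb n u‖ₑ ^ 2 ≤ landauForm b u :=
  le_iInf fun _ => le_iInf fun _ => le_iInf fun h₁ => le_iInf fun h₂ =>
    (enorm_momenta_eq hb h₁ h₂).ge

theorem landauForm_eq_tsum {b : ℝ} (hb : 0 < b) {u v₁ v₂ : L2}
    (h₁ : IsMagneticMomentum (1, 0) (fun _ => 0) u v₁)
    (h₂ : IsMagneticMomentum (0, 1) (fun x => b * x.1) u v₂) :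
    landauForm b u = ∑' n : ℕ, ENNReal.ofReal (b * (2 * n + 1)) * ‖levelCoeff hb n u‖ₑ ^ 2 :=
  le_antisymm ((iInf_le_of_le v₁ <| iInf_le_of_le v₂ <| iInf_le_of_le h₁ <| iInf_le _ h₂).trans
    (enorm_momenta_eq hb h₁ h₂).le) (tsum_levelCoeff_le_landauForm hb u)

theorem lower_psi {b : ℝ} (hb : 0 < b) (n m : ℕ) :
    lower b (psi hb n m) = ((√(n : ℝ) : ℝ) : ℂ) • psi hb (n - 1) m := by
  cases n with
  | zero => simp [lower_psi_zero]
  | succ n => rw [lower_psi_succ, Nat.add_sub_cancel]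

theorem exists_weak_image_level {b : ℝ} (hb : 0 < b) {T : Module.End ℂ Sch}
    (hT : ∀ φ χ : Sch, inner ℂ (T φ).toL2 χ.toL2 = inner ℂ φ.toL2 (T χ).toL2) (c d : ℂ)
    (hcd : ∀ φ, T φ = c • lower b φ + d • raise b φ) (n : ℕ) (g : Seq) :
    ∃ v : L2, ∀ φ : Sch, inner ℂ φ.toL2 v = inner ℂ (T φ).toL2 (levelMap hb n g) := by
  -- On level `n`, lowering has weight `√n` and raising `√(n+1)`. For `n = 0` the truncated index `n
  -- - 1` is harmless because its weight is zero.
  let V : Seq →L[ℂ] L2 := (c * ((√(n : ℝ) : ℝ) : ℂ)) • levelMap hb (n - 1) +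
    (d * ((√((n + 1 : ℕ) : ℝ) : ℝ) : ℂ)) • levelMap hb (n + 1)
  refine ⟨V g, fun φ => ?_⟩
  have : innerSL ℂ φ.toL2 ∘L V = innerSL ℂ (T φ).toL2 ∘L levelMap hb n := by
    refine clm_ext_hilbertBasis seqBasis fun m => ?_
    simp only [ContinuousLinearMap.comp_apply, innerSL_apply_apply]
    rw [levelMap_seqBasis, hT, hcd, lower_psi, raise_psi, smul_smul, smul_smul, Sch.toL2_add,
      Sch.toL2_smul, Sch.toL2_smul]
    simp only [V, add_apply, smul_apply, levelMap_seqBasis]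
  exact congrArg (fun S : Seq →L[ℂ] ℂ => S g) this

theorem exists_weak_image_sum {b : ℝ} (hb : 0 < b) {T : Module.End ℂ Sch}
    (hT : ∀ φ χ : Sch, inner ℂ (T φ).toL2 χ.toL2 = inner ℂ φ.toL2 (T χ).toL2) (c d : ℂ)
    (hcd : ∀ φ, T φ = c • lower b φ + d • raise b φ) (s : Finset ℕ) (g : ℕ → Seq) :
    ∃ v : L2, ∀ φ : Sch, inner ℂ φ.toL2 v = inner ℂ (T φ).toL2 (∑ n ∈ s, levelMap hb n (g n)) := by
  choose v hv using fun n => exists_weak_image_level hb hT c d hcd n (g n)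
  refine ⟨∑ n ∈ s, v n, fun φ => ?_⟩
  rw [inner_sum, inner_sum]
  exact Finset.sum_congr rfl fun n _ => hv n φ

theorem landauForm_sum_levelMap {b : ℝ} (hb : 0 < b) (s : Finset ℕ) (g : ℕ → Seq) :
    landauForm b (∑ n ∈ s, levelMap hb n (g n)) = ∑' n : ℕ, ENNReal.ofReal (b * (2 * n + 1)) *
      ‖levelCoeff hb n (∑ n ∈ s, levelMap hb n (g n))‖ₑ ^ 2 := by
  obtain ⟨v₁, h₁⟩ := exists_weak_image_sum hb (T := kin1) (inner_momentum_toL2 _ _)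
    ((√(b / 2) : ℝ) : ℂ) ((√(b / 2) : ℝ) : ℂ)
    (fun φ => by rw [kin1_eq hb, smul_add]) s g
  obtain ⟨v₂, h₂⟩ := exists_weak_image_sum hb (T := kin2 b) (inner_momentum_toL2 _ _)
    (Complex.I * ((√(b / 2) : ℝ) : ℂ)) (-Complex.I * ((√(b / 2) : ℝ) : ℂ))
    (fun φ => by rw [kin2_eq hb]; module) s g
  exact landauForm_eq_tsum hb ((isMagneticMomentum_kin1_iff _ _).2 h₁)
    ((isMagneticMomentum_kin2_iff b _ _).2 h₂)

/-! ### Square roots and forms -/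

section

variable {H : Type*} [NormedAddCommGroup H] [InnerProductSpace ℂ H] [CompleteSpace H]

theorem isSelfAdjoint_opSqrt (T : H →L[ℂ] H) : IsSelfAdjoint (opSqrt T) :=
  IsSelfAdjoint.of_nonneg (CFC.sqrt_nonneg T)

theorem opSqrt_mul_opSqrt {T : H →L[ℂ] H} (hT : 0 ≤ T) : opSqrt T * opSqrt T = T :=
  CFC.sqrt_mul_sqrt_self T hT

theorem opSqrt_mul_self {S : H →L[ℂ] H} (hS : 0 ≤ S) : opSqrt (S * S) = S :=
  CFC.sqrt_unique rfl hS

theorem commute_opSqrt {T U : H →L[ℂ] H} (h : Commute T U) : Commute (opSqrt T) U :=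
  h.cfcₙ_nnreal _

end

theorem re_inner_mul_self {S : L2 →L[ℂ] L2} (hS : IsSelfAdjoint S) (f : L2) :
    RCLike.re (inner ℂ f ((S * S) f)) = ‖S f‖ ^ 2 := by
  rw [← inner_self_eq_norm_sq (𝕜 := ℂ)]
  congr 1
  change inner ℂ f (S (S f)) = _
  rw [← ContinuousLinearMap.adjoint_inner_left, hS.adjoint_eq]

theorem opForm_mul_self {S : L2 →L[ℂ] L2} (hS : IsSelfAdjoint S) (f : L2) :
    opForm (S * S) f = ‖S f‖ₑ ^ 2 := by
  rw [opForm, re_inner_mul_self hS, ENNReal.ofReal_pow (norm_nonneg _), ofReal_norm]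

theorem opForm_eq {η : L2 →L[ℂ] L2} (hη : 0 ≤ η) (f : L2) : opForm η f = ‖opSqrt η f‖ₑ ^ 2 := by
  rw [← opForm_mul_self (isSelfAdjoint_opSqrt η), opSqrt_mul_opSqrt hη]

theorem enorm_opSqrt_le {η : L2 →L[ℂ] L2} (hη : 0 ≤ η) (h1 : η ≤ 1) (f : L2) :
    ‖opSqrt η f‖ₑ ≤ ‖f‖ₑ := by
  have h := (ContinuousLinearMap.le_def _ _).1 h1
  have h2 := h.re_inner_nonneg_right f
  rw [sub_apply, inner_sub_right, map_sub, one_apply_eq_self, inner_self_eq_norm_sq,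
    ← opSqrt_mul_opSqrt hη, re_inner_mul_self (isSelfAdjoint_opSqrt η)] at h2
  rw [← ofReal_norm, ← ofReal_norm]
  exact ENNReal.ofReal_le_ofReal (abs_le_of_sq_le_sq' (by linarith) (norm_nonneg _)).2

theorem localTrace_opForm {η S : L2 →L[ℂ] L2} (h : ∀ f, opForm η f = ‖S f‖ₑ ^ 2)
    {Q : Set (ℝ × ℝ)} (hQ : MeasurableSet Q) :
    localTrace (opForm η) Q hQ = hsNormSq (S * cutoff Q hQ) := by
  simp only [localTrace, h]
  rfl

theorem volume_square {L : ℝ} (hL : 0 < L) : volume (square L) = ENNReal.ofReal (L ^ 2) := by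
  rw [measure_congr (square_ae_eq_cell L), volume_cell hL]

/-! ### The lower bound -/

/-- Termwise, `2N+1 ≤ (2n+1) + 2 (N-n)` with truncated subtraction, and the corrections `2 (N-n)`
sum to `N (N+1)`. The additive form avoids subtraction in `ℝ≥0∞`. -/
theorem bathtub {τ : ℕ → ℝ≥0∞} {M : ℝ≥0∞} (hτ : ∀ n, τ n ≤ M) (N : ℕ) :
    ((2 * N + 1 : ℕ) : ℝ≥0∞) * ∑' n, τ n ≤
      ∑' n : ℕ, ((2 * n + 1 : ℕ) : ℝ≥0∞) * τ n + ((N * (N + 1) : ℕ) : ℝ≥0∞) * M := by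
  have h1 : ∑' n : ℕ, ((2 * (N - n) : ℕ) : ℝ≥0∞) * τ n ≤ ((N * (N + 1) : ℕ) : ℝ≥0∞) * M := by
    rw [tsum_eq_sum (s := Finset.range (N + 1)) (fun n hn => by
      rw [Finset.mem_range] at hn
      rw [show N - n = 0 by omega]
      simp)]
    have h2 : N * (N + 1) = ∑ n ∈ Finset.range (N + 1), 2 * (N - n) := by
      have h := Finset.sum_range_reflect (fun n => 2 * n) (N + 1)
      rw [Nat.add_sub_cancel] at h
      rw [h, ← Finset.mul_sum, mul_comm 2, Finset.sum_range_id_mul_two, Nat.add_sub_cancel,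
        mul_comm]
    rw [h2, Nat.cast_sum, Finset.sum_mul]
    exact Finset.sum_le_sum fun n _ => by gcongr; exact hτ n
  refine le_trans ?_ (add_le_add_right h1 _)
  rw [← ENNReal.tsum_mul_left, ← ENNReal.tsum_add]
  refine ENNReal.tsum_le_tsum fun n => ?_
  rw [← add_mul, ← Nat.cast_add]
  exact mul_le_mul' (Nat.cast_le.2 (by omega)) le_rfl

theorem localTrace_kineticForm_ge {b ρ L : ℝ} (hb : 0 < b) (hL : 0 < L) {η : L2 →L[ℂ] L2}
    (hη : IsAdmissible b ρ η) (N : ℕ) :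
    ENNReal.ofReal b * ((2 * N + 1 : ℕ) * (ENNReal.ofReal ρ * ENNReal.ofReal (L ^ 2))) ≤
      localTrace (kineticForm b η) (square L) (measurableSet_square L) + ENNReal.ofReal b *
        ((N * (N + 1) : ℕ) * (ENNReal.ofReal (b / (2 * Real.pi)) * ENNReal.ofReal (L ^ 2))) := by
  set S := opSqrt η with hS
  have hSc : ∀ R, Commute S (magTranslation b R) := fun R => commute_opSqrt (hη.invariant R)
  have hQ := measurableSet_square L
  set C := cutoff (square L) hQ with hC
  have hcell : C = cutoff (cell L 0) (measurableSet_cell L 0) :=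
    cutoff_congr _ _ (square_ae_eq_cell L)
  let τ : ℕ → ℝ≥0∞ := fun n => hsNormSq (levelCoeff hb n ∘L S ∘L C)
  -- The trace property replaces `P n S` by its adjoint `S P n`, where the contraction `S = η^{1/2}`
  -- stands on the left and can be dropped.
  have hτ : ∀ n, τ n ≤ ENNReal.ofReal (b / (2 * Real.pi)) * ENNReal.ofReal (L ^ 2) := by
    intro n
    rw [← volume_square hL, ← hsNormSq_levelCoeff_cutoff_eq hb n hQ]
    have e1 : τ n = hsNormSq ((levelUnit hb n n * S) * C) :=
      hsNormSq_congr fun f => (enorm_levelUnit hb n n _).symm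
    have hT : ∀ R, Commute (levelUnit hb n n * S) (magTranslation b R) := fun R =>
      (commute_levelUnit hb n n R).mul_left (hSc R)
    have e2 : ContinuousLinearMap.adjoint (levelUnit hb n n * S) = S * levelUnit hb n n := by
      change ContinuousLinearMap.adjoint (levelUnit hb n n ∘L S) = _
      rw [ContinuousLinearMap.adjoint_comp, adjoint_levelUnit, (isSelfAdjoint_opSqrt η).adjoint_eq]
      rfl
    rw [e1, hcell, ← hsNormSq_cell_adjoint hL hT, e2, ← hcell]
    refine hsNormSq_mono fun f => ?_
    refine (enorm_opSqrt_le hη.nonneg hη.le_one _).trans ?_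
    exact (enorm_levelUnit hb n n _).le
  have hsum : ∑' n, τ n = ENNReal.ofReal ρ * ENNReal.ofReal (L ^ 2) := by
    have h := hη.density (square L) hQ (by
      exact (Metric.isBounded_Icc _ _).prod (Metric.isBounded_Icc _ _))
    rw [localTrace_opForm (opForm_eq hη.nonneg), setLIntegral_const, volume_square hL] at h
    rw [← h]
    simp only [τ, hsNormSq]
    rw [ENNReal.tsum_comm]
    refine tsum_congr fun i => ?_
    exact (enorm_sq_eq_tsum_levelCoeff hb _).symm
  have hkin : ENNReal.ofReal b * ∑' n : ℕ, ((2 * n + 1 : ℕ) : ℝ≥0∞) * τ n ≤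
      localTrace (kineticForm b η) (square L) hQ := by
    rw [← ENNReal.tsum_mul_left]
    simp only [τ, hsNormSq, localTrace, kineticForm]
    simp_rw [← ENNReal.tsum_mul_left]
    rw [ENNReal.tsum_comm]
    refine ENNReal.tsum_le_tsum fun i => ?_
    refine le_trans (le_of_eq (tsum_congr fun n => ?_)) (tsum_levelCoeff_le_landauForm hb _)
    rw [← mul_assoc, ← ENNReal.ofReal_natCast, ← ENNReal.ofReal_mul hb.le]
    push_cast
    rfl
  calc _ = ENNReal.ofReal b * (((2 * N + 1 : ℕ) : ℝ≥0∞) * ∑' n, τ n) := by rw [hsum]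
    _ ≤ ENNReal.ofReal b * (∑' n : ℕ, ((2 * n + 1 : ℕ) : ℝ≥0∞) * τ n + ((N * (N + 1) : ℕ) : ℝ≥0∞) *
        (ENNReal.ofReal (b / (2 * Real.pi)) * ENNReal.ofReal (L ^ 2))) := by
        gcongr
        exact bathtub hτ N
    _ ≤ _ := by
        rw [mul_add]
        gcongr

/-! ### The minimiser -/

theorem eq_of_levelCoeff_eq {b : ℝ} (hb : 0 < b) {f g : L2}
    (h : ∀ n, levelCoeff hb n f = levelCoeff hb n g) : f = g := by
  rw [← sub_eq_zero, ← enorm_eq_zero, ← pow_eq_zero_iff two_ne_zero,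
    enorm_sq_eq_tsum_levelCoeff hb]
  simp [h]

/-- The operator acting as `s n` on the Landau levels `n < N`, and as `0` on the others. -/
def levelSum {b : ℝ} (hb : 0 < b) (s : ℕ → ℝ) (N : ℕ) : L2 →L[ℂ] L2 :=
  ∑ n ∈ Finset.range N, (s n : ℂ) • levelUnit hb n n

theorem levelSum_apply {b : ℝ} (hb : 0 < b) (s : ℕ → ℝ) (N : ℕ) (f : L2) :
    levelSum hb s N f =
      ∑ n ∈ Finset.range N, levelMap hb n ((s n : ℂ) • levelCoeff hb n f) := by
  rw [levelSum, sum_apply]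
  refine Finset.sum_congr rfl fun n _ => ?_
  rw [smul_apply, levelUnit_apply, map_smul]

theorem levelCoeff_levelSum {b : ℝ} (hb : 0 < b) (s : ℕ → ℝ) (N k : ℕ) (f : L2) :
    levelCoeff hb k (levelSum hb s N f) =
      if k ∈ Finset.range N then (s k : ℂ) • levelCoeff hb k f else 0 := by
  rw [levelSum_apply, map_sum]
  simp_rw [levelCoeff_levelMap]
  rw [Finset.sum_ite_eq]

theorem levelSum_mul_levelSum {b : ℝ} (hb : 0 < b) (s t : ℕ → ℝ) (N : ℕ) :
    levelSum hb s N * levelSum hb t N = levelSum hb (fun n => s n * t n) N := by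
  refine ContinuousLinearMap.ext fun f => eq_of_levelCoeff_eq hb fun k => ?_
  change levelCoeff hb k (levelSum hb s N (levelSum hb t N f)) = _
  simp only [levelCoeff_levelSum]
  split_ifs
  · rw [smul_smul, Complex.ofReal_mul]
  · rfl

theorem isSelfAdjoint_levelSum {b : ℝ} (hb : 0 < b) (s : ℕ → ℝ) (N : ℕ) :
    IsSelfAdjoint (levelSum hb s N) := by
  refine isSelfAdjoint_sum _ fun n _ => IsSelfAdjoint.smul ?_ ?_
  · exact Complex.conj_ofReal _
  · rw [ContinuousLinearMap.isSelfAdjoint_iff', adjoint_levelUnit]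

theorem levelSum_nonneg {b : ℝ} (hb : 0 < b) {s : ℕ → ℝ} (hs : ∀ n, 0 ≤ s n) (N : ℕ) :
    0 ≤ levelSum hb s N := by
  have h := star_mul_self_nonneg (levelSum hb (fun n => √(s n)) N)
  rw [(isSelfAdjoint_levelSum hb _ N).star_eq, levelSum_mul_levelSum] at h
  simpa only [Real.mul_self_sqrt (hs _)] using h

theorem opSqrt_levelSum_mul_self {b : ℝ} (hb : 0 < b) {s : ℕ → ℝ} (hs : ∀ n, 0 ≤ s n) (N : ℕ) :
    opSqrt (levelSum hb s N * levelSum hb s N) = levelSum hb s N :=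
  opSqrt_mul_self (levelSum_nonneg hb hs N)

theorem enorm_levelCoeff_levelSum_sq {b : ℝ} (hb : 0 < b) (s : ℕ → ℝ) (N k : ℕ) (f : L2) :
    ‖levelCoeff hb k (levelSum hb s N f)‖ₑ ^ 2 =
      if k ∈ Finset.range N then ENNReal.ofReal (s k ^ 2) * ‖levelCoeff hb k f‖ₑ ^ 2 else 0 := by
  rw [levelCoeff_levelSum]
  split_ifs
  · rw [enorm_smul, mul_pow, ← ofReal_norm, ← ENNReal.ofReal_pow (norm_nonneg _),
      Complex.norm_real, Real.norm_eq_abs, sq_abs]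
  · simp

theorem enorm_levelSum_le {b : ℝ} (hb : 0 < b) {s : ℕ → ℝ} (hs : ∀ n, s n ^ 2 ≤ 1) (N : ℕ)
    (f : L2) : ‖levelSum hb s N f‖ₑ ^ 2 ≤ ‖f‖ₑ ^ 2 := by
  rw [enorm_sq_eq_tsum_levelCoeff hb, enorm_sq_eq_tsum_levelCoeff hb f]
  refine ENNReal.tsum_le_tsum fun k => ?_
  rw [enorm_levelCoeff_levelSum_sq]
  split_ifs
  · refine mul_le_of_le_one_left zero_le ?_
    exact ENNReal.ofReal_le_one.2 (hs k)
  · exact zero_le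

/-- Serves twice: weight `1` gives the density, weight `b (2k+1)` the kinetic energy. -/
theorem tsum_weight_levelSum_cutoff {b : ℝ} (hb : 0 < b) (s : ℕ → ℝ) (N : ℕ) (w : ℕ → ℝ≥0∞)
    {Q : Set (ℝ × ℝ)} (hQ : MeasurableSet Q) :
    ∑' i, ∑' k, w k * ‖levelCoeff hb k (levelSum hb s N (cutoff Q hQ (basis i)))‖ₑ ^ 2 =
      ∑ k ∈ Finset.range N, w k * (ENNReal.ofReal (s k ^ 2) *
        (ENNReal.ofReal (b / (2 * Real.pi)) * volume Q)) := by
  rw [ENNReal.tsum_comm, tsum_eq_sum (s := Finset.range N) (fun k hk => by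
    simp [enorm_levelCoeff_levelSum_sq, hk])]
  refine Finset.sum_congr rfl fun k hk => ?_
  simp only [enorm_levelCoeff_levelSum_sq, hk, if_true]
  rw [ENNReal.tsum_mul_left, ENNReal.tsum_mul_left, ← hsNormSq_levelCoeff_cutoff_eq hb k hQ]
  rfl

theorem localTrace_opForm_levelSum {b : ℝ} (hb : 0 < b) (s : ℕ → ℝ) (N : ℕ)
    {Q : Set (ℝ × ℝ)} (hQ : MeasurableSet Q) :
    localTrace (opForm (levelSum hb s N * levelSum hb s N)) Q hQ =
      ENNReal.ofReal (b / (2 * Real.pi) * ∑ k ∈ Finset.range N, s k ^ 2) * volume Q := by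
  have h := tsum_weight_levelSum_cutoff hb s N 1 hQ
  simp only [Pi.one_apply, one_mul, ← enorm_sq_eq_tsum_levelCoeff hb] at h
  rw [localTrace_opForm (opForm_mul_self (isSelfAdjoint_levelSum hb s N))]
  refine h.trans ?_
  rw [← Finset.sum_mul, ← ENNReal.ofReal_sum_of_nonneg fun _ _ => sq_nonneg _, ← mul_assoc,
    ← ENNReal.ofReal_mul (Finset.sum_nonneg fun _ _ => sq_nonneg _), mul_comm (b / _)]

theorem localTrace_kineticForm_levelSum {b : ℝ} (hb : 0 < b) {s : ℕ → ℝ} (hs : ∀ n, 0 ≤ s n)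
    (N : ℕ) {Q : Set (ℝ × ℝ)} (hQ : MeasurableSet Q) :
    localTrace (kineticForm b (levelSum hb s N * levelSum hb s N)) Q hQ =
      ENNReal.ofReal (b ^ 2 / (2 * Real.pi) * ∑ k ∈ Finset.range N, (2 * k + 1) * s k ^ 2) *
        volume Q := by
  have h := tsum_weight_levelSum_cutoff hb s N (fun k => ENNReal.ofReal (b * (2 * k + 1))) hQ
  have h2 : ∀ f, kineticForm b (levelSum hb s N * levelSum hb s N) f = ∑' k : ℕ,
      ENNReal.ofReal (b * (2 * k + 1)) * ‖levelCoeff hb k (levelSum hb s N f)‖ₑ ^ 2 := by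
    intro f
    rw [kineticForm, opSqrt_levelSum_mul_self hb hs, levelSum_apply, landauForm_sum_levelMap]
  simp only [localTrace, h2]
  refine h.trans ?_
  have hp : ∀ k ∈ Finset.range N, 0 ≤ (2 * (k : ℝ) + 1) * s k ^ 2 := fun k _ => by positivity
  rw [Finset.mul_sum, ENNReal.ofReal_sum_of_nonneg fun k hk => mul_nonneg (by positivity) (hp k hk),
    Finset.sum_mul]
  refine Finset.sum_congr rfl fun k _ => ?_
  rw [← mul_assoc, ← mul_assoc, ← ENNReal.ofReal_mul (by positivity),
    ← ENNReal.ofReal_mul (by positivity)]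
  congr 2
  ring

theorem isAdmissible_levelSum {b ρ : ℝ} (hb : 0 < b) {s : ℕ → ℝ} {N : ℕ}
    (hs1 : ∀ n, s n ^ 2 ≤ 1) (hρ : b / (2 * Real.pi) * ∑ k ∈ Finset.range N, s k ^ 2 = ρ) :
    IsAdmissible b ρ (levelSum hb s N * levelSum hb s N) where
  selfAdjoint := by
    rw [levelSum_mul_levelSum]
    exact isSelfAdjoint_levelSum hb _ N
  nonneg := by
    rw [levelSum_mul_levelSum]
    exact levelSum_nonneg hb (fun _ => mul_self_nonneg _) N
  le_one := by
    rw [ContinuousLinearMap.le_def, ContinuousLinearMap.isPositive_def']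
    refine ⟨(IsSelfAdjoint.one _).sub ?_, fun f => ?_⟩
    · rw [levelSum_mul_levelSum]
      exact isSelfAdjoint_levelSum hb _ N
    · rw [ContinuousLinearMap.reApplyInnerSelf_apply, inner_re_symm, sub_apply, inner_sub_right,
        map_sub, one_apply_eq_self, inner_self_eq_norm_sq,
        re_inner_mul_self (isSelfAdjoint_levelSum hb s N)]
      have h := enorm_levelSum_le hb hs1 N f
      rw [← ofReal_norm, ← ofReal_norm, ← ENNReal.ofReal_pow (norm_nonneg _),
        ← ENNReal.ofReal_pow (norm_nonneg _), ENNReal.ofReal_le_ofReal_iff (by positivity)] at h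
      linarith
  density Q hQ _ := by
    rw [localTrace_opForm_levelSum, setLIntegral_const, hρ]
  invariant R := by
    have : Commute (levelSum hb s N) (magTranslation b R) :=
      Commute.sum_left _ _ _ fun n _ => (commute_levelUnit hb n n R).smul_left _
    exact this.mul_left this

end LandauGas

end

/-! ### Matching the two bounds -/

theorem mainTheorem4 (b ρ : ℝ) (hb : 0 < b) (hρ : 0 < ρ) :
    LandauGas.omega2d b ρ =
      ENNReal.ofReal (Real.pi * ρ ^ 2 + b ^ 2 / (4 * Real.pi) *
        (Int.fract (2 * Real.pi * ρ / b) * (1 - Int.fract (2 * Real.pi * ρ / b)))) := by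
  open LandauGas in
  have hπ := Real.pi_pos
  set x := 2 * Real.pi * ρ / b with hx
  have hx0 : 0 ≤ x := by positivity
  set θ := Int.fract x with hθ
  set N := ⌊x⌋₊ with hN
  have hxN : x = N + θ := by
    rw [hθ, Int.fract, hN, ← natCast_floor_eq_intCast_floor hx0]
    ring
  have hθ0 : 0 ≤ θ := Int.fract_nonneg x
  have hθ1 : θ < 1 := Int.fract_lt_one x
  have hρx : ρ = b / (2 * Real.pi) * (N + θ) := by
    rw [← hxN, hx]
    field_simp
  set E := Real.pi * ρ ^ 2 + b ^ 2 / (4 * Real.pi) * (θ * (1 - θ)) with hE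
  have hE0 : 0 ≤ E := by
    have : 0 ≤ 1 - θ := by linarith
    positivity
  -- In terms of `N` and `θ` the energy is affine in `θ`: it interpolates linearly between
  -- completely filled levels.
  have hE1 : E = b ^ 2 / (4 * Real.pi) * (N ^ 2 + (2 * N + 1) * θ) := by
    rw [hE, hρx]
    field_simp
    ring
  have htwo : ENNReal.ofReal E = ENNReal.ofReal (2 * E) / 2 := by
    rw [ENNReal.ofReal_mul (by norm_num), ENNReal.ofReal_ofNat, mul_comm,
      ENNReal.mul_div_cancel_right (by norm_num) (by norm_num)]
  refine le_antisymm ?_ ?_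
  -- The state is the square of `levelSum`, so weight `θ` on level `N` requires the coefficient
  -- `√θ`. The sum is truncated at `N + 1`, so larger indices play no role.
  · let s : ℕ → ℝ := fun n => if n < N then 1 else √θ
    have hs0 : ∀ n, 0 ≤ s n := fun n => by
      simp only [s]; split_ifs <;> positivity
    have hs1 : ∀ n, s n ^ 2 ≤ 1 := fun n => by
      simp only [s]
      split_ifs
      · norm_num
      · rw [Real.sq_sqrt hθ0]; exact hθ1.le
    have hsN : s N ^ 2 = θ := by simp [s, Real.sq_sqrt hθ0]
    have hsk : ∀ k ∈ Finset.range N, s k ^ 2 = 1 := fun k hk => by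
      simp [s, Finset.mem_range.1 hk]
    have h1 : ∑ k ∈ Finset.range (N + 1), s k ^ 2 = N + θ := by
      rw [Finset.sum_range_succ, Finset.sum_congr rfl hsk, hsN]
      simp
    have h2 : ∑ k ∈ Finset.range (N + 1), (2 * (k : ℝ) + 1) * s k ^ 2 =
        N ^ 2 + (2 * N + 1) * θ := by
      rw [Finset.sum_range_succ, Finset.sum_congr rfl fun k hk => by rw [hsk k hk, mul_one], hsN]
      rw [show ∀ n : ℕ, ∑ k ∈ Finset.range n, (2 * (k : ℝ) + 1) = n ^ 2 from fun n => by
        induction n with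
        | zero => simp
        | succ n ih => rw [Finset.sum_range_succ, ih]; push_cast; ring]
    refine sInf_le ⟨_, ENNReal.ofReal (2 * E), isAdmissible_levelSum hb hs1 (N := N + 1) ?_, ?_,
      htwo⟩
    · rw [h1, ← hρx]
    -- Every level has constant density, so the quotient is already constant for `L > 0`.
    · refine tendsto_const_nhds.congr' ?_
      filter_upwards [eventually_gt_atTop 0] with L hL
      rw [localTrace_kineticForm_levelSum hb hs0, h2, volume_square hL,
        ENNReal.mul_div_cancel_right _ ENNReal.ofReal_ne_top]
      · congr 1
        rw [hE1]
        field_simp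
        ring
      · rw [Ne, ENNReal.ofReal_eq_zero, not_le]
        positivity
  · refine le_sInf ?_
    rintro _ ⟨η, t, hη, ht, rfl⟩
    rw [htwo]
    refine ENNReal.div_le_div_right (ge_of_tendsto ht ?_) _
    filter_upwards [eventually_gt_atTop 0] with L hL
    have hL2 : 0 < L ^ 2 := by positivity
    rw [ENNReal.le_div_iff_mul_le (Or.inl (by simpa using hL.ne')) (Or.inl ENNReal.ofReal_ne_top),
      ← ENNReal.ofReal_mul (by positivity)]
    -- The local bound holds for every natural number; `⌊2πρ/b⌋`, the index of the partially filled
    -- level, makes it match `2 E`.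
    have h := localTrace_kineticForm_ge hb hL hη N
    rw [← ENNReal.ofReal_natCast, ← ENNReal.ofReal_natCast, ← ENNReal.ofReal_mul (by positivity),
      ← ENNReal.ofReal_mul (by positivity), ← ENNReal.ofReal_mul (by positivity),
      ← ENNReal.ofReal_mul (by positivity), ← ENNReal.ofReal_mul (by positivity),
      ← ENNReal.ofReal_mul (by positivity)] at h
    refine le_trans (le_of_eq ?_) (tsub_le_iff_right.2 h)
    rw [← ENNReal.ofReal_sub _ (by positivity)]
    congr 1
    rw [hE1, hρx]
    push_cast
    field_simp
    ring
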